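/- **Setting.** Let $E$ be a standard Borel space and let $K(\cdot\mid y_1,y_2)$ be a probability kernel from $E^2$ to $E$. The parents of a site $(i,j)\in\mathbb Z^2$ are $(i-1,j)$ and $(i,j-1)$. For $S\subset\mathbb Z^2$, $\partial_I S$ is the set of sites of $S$ with at least one parent outside $S$. Let $\Lambda_{m,n}=\{1,\dots,m\}\times\{1,\dots,n\}$. The unilateral field $\mathbf X^{\mathbf x}$ with boundary conditions $\mathbf x=\{x_{i,0},x_{0,i}: i\ge 1\}$ has on each box $\Lambda_{m,n}$ the law $\prod_{i=1}^m\prod_{j=1}^n K(dx_{i,j}\mid x_{i-1,j},x_{i,j-1})$. The kernel $K$ is *uniformly ergodic* if there is a translation-invariant random field $\mathbf X'$ on $\mathbb Z^2$ (the equilibrium field) such that, for all $m,n$, the total variation distance between the law of $\mathbf X^{\mathbf x}_{(h,l)+\Lambda_{m,n}}$ and the law of $\mathbf X'_{\Lambda_{m,n}}$ tends to $0$ as $h,l\to\infty$, uniformly in $\mathbf x$. **Assumption.** There are a measurable set $C\subset E$, a probability measure $\phi$ on $E$ and constants $\rho_1,\rho_2>0$ with $\rho_1^2\rho_2>2/3$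 such that $K(C\mid y_1,y_2)\ge\rho_1$ for all $y_1,y_2\in E$, and $K(A\mid y_1,y_2)\ge\rho_2\,\phi(A)$ for all $y_1,y_2\in C$ and all measurable $A$. (Necessarily $\rho_1,\rho_2\le 1$.) **Coupling.** Let $(U_{1,p},U_{2,p})_{p\in\mathbb Z^2}$ be independent and uniform on $(0,1)^2$, and let $U$ be uniform on $(0,1)$. Consider measurable $f_0:(0,1)\to E$ and $f_1,\dots,f_4:(0,1)\times E^2\to E$ such that - $f_0(U)\sim\phi$ and $f_2(U;y_1,y_2)\sim K(\cdot\mid y_1,y_2)$; - $K(\cdot\mid y_1,y_2)=\rho_2\phi+(1-\rho_2)\,\mathrm{law}\,f_1(U;y_1,y_2)$ for $y_1,y_2\in C$, and $f_1(U;y_1,y_2)\sim K(\cdot\mid y_1,y_2)$ otherwise; - $f_3(U;y_1,y_2)\sim K(\cdot\cap C\mid y_1,y_2)/K(C\mid y_1,y_2)$; - $K(\cdot\mid y_1,y_2)=\rho_1\,\mathrm{law}\,f_3(U;y_1,y_2)+(1-\rho_1)\,\mathrm{law}\,f_4(U;y_1,y_2)$. At sites with $i+j$ even use $s_0(u_1,u_2;y_1,y_2)$,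 which equals $f_0(u_1)$ if $y_1,y_2\in C$ and $u_2<\rho_2$, equals $f_1(u_1;y_1,y_2)$ if $y_1,y_2\in C$ and $u_2\ge\rho_2$, and equals $f_2(u_1;y_1,y_2)$ otherwise. At sites with $i+j$ odd use $s_1(u_1,u_2;y_1,y_2)$, which equals $f_3(u_1;y_1,y_2)$ if $u_2<\rho_1$ and $f_4(u_1;y_1,y_2)$ otherwise. For $h+k$ even put $W_{h,k}=0$ if $U_{2,(h-1,k)}<\rho_1$, $U_{2,(h,k-1)}<\rho_1$ and $U_{2,(h,k)}<\rho_2$, and $W_{h,k}=1$ otherwise. In the block graph on the even sites, the parents of $(h,k)$ are $(h-2,k)$, $(h-1,k-1)$ and $(h,k-2)$; an increasing path in it, of positive length, is open if $W=1$ at all its vertices except possibly the first. **Simulation region.** For a finite $\Lambda\subset\mathbb Z^2$ let $\bar\Lambda$ be $\Lambda$ together with the parents of its odd sites (so $\partial_I\bar\Lambda$ consists of even sites, and $\bar\Lambda=\Lambda$ if $\partial_I\Lambda$ does). Let $\sigma$ be the set of even sites joined to $\partial_I\bar\Lambda$ by an open path, and let $D(\Lambda)$ be the union of $\bar\Lambda$,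 $\sigma$ and the lattice parents of all sites of $\partial_I\bar\Lambda\cup\sigma$ at which $W=1$. For finite $B\subset\mathbb Z^2$ let $\Upsilon^B$ be the configuration on $B$ that equals $f_0(U_{1,p})$ at each $p\in\partial_I B$ and is computed at the other sites of $B$ by the recursion $X_{i,j}=s(U_{1,(i,j)},U_{2,(i,j)};X_{i-1,j},X_{i,j-1})$, where $s=s_0$ for $i+j$ even and $s=s_1$ for $i+j$ odd. **Theorem.** Under the Assumption: 1. $K$ is uniformly ergodic. 2. (Perfect simulation.) Functions $f_0,\dots,f_4$ as above exist, and for every choice of them and every finite $\Lambda\subset\mathbb Z^2$ the restriction of $\Upsilon^{D(\Lambda)}$ to $\Lambda$ has the law of $\mathbf X'_\Lambda$, where $\mathbf X'$ is the equilibrium field of $K$. 3. (Expected cost.) There is a constant $c<\infty$ such that $|\Lambda|\le\mathbb E|D(\Lambda)|\le|\Lambda|+c\,|\partial_I\Lambda|$ for every finite $\Lambda\subset\mathbb Z^2$. In particular $D(\Lambda)$ is almost surely finite. -/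

import Mathlib

open MeasureTheory ProbabilityTheory Filter Topology
open scoped ENNReal NNReal

/-! ### Sites of the oriented lattice `ℤ²` -/

/-- Sites of the lattice `ℤ²`. -/
abbrev Site : Type := ℤ × ℤ

/-- The horizontal parent `(i-1, j)` of `(i, j)`. -/
def leftParent (p : Site) : Site := (p.1 - 1, p.2)

/-- The vertical parent `(i, j-1)` of `(i, j)`. -/
def belowParent (p : Site) : Site := (p.1, p.2 - 1)

/-- The internal boundary of `S`: the sites of `S` with at least one parent outside `S`. -/
def internalBoundary (S : Set Site) : Set Site :=
  {p | p ∈ S ∧ (leftParent p ∉ S ∨ belowParent p ∉ S)}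

/-- The box `{1, …, m} × {1, …, n}`. -/
noncomputable def boxSites (m n : ℕ) : Finset Site := Finset.Icc 1 (m : ℤ) ×ˢ Finset.Icc 1 (n : ℤ)

/-- The sites of the box `{1, …, m} × {1, …, n}`, row after row; each site comes after those of
its parents that lie in the box. -/
def boxList (m n : ℕ) : List Site :=
  (List.range n).flatMap fun j => (List.range m).map fun i => ((i : ℤ) + 1, (j : ℤ) + 1)

/-! ### Unilateral fields with kernel `K`, ergodicity -/

section Fields

variable {E : Type*} [MeasurableSpace E]

/-- One step of the sequential construction of the field: given the current (random)
configuration, of law `μ`, the value at the site `p` is redrawn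
from `K(· | value at (i-1, j), value at (i, j-1))`. -/
noncomputable def resample (K : Kernel (E × E) E) (μ : Measure (Site → E)) (p : Site) :
    Measure (Site → E) :=
  μ.bind fun y => (K (y (leftParent p), y (belowParent p))).map (Function.update y p)

/-- The law of the unilateral field with kernel `K` in the box `{1, …, M} × {1, …, N}`, with
deterministic boundary conditions `x (i, 0)`, `x (0, j)`: on the coordinates of the box this is
`∏ i j, K(d x_{i,j} | x_{i-1,j}, x_{i,j-1})`. The coordinates outside the box are left equal to
those of `x`; of these only the ones at `(i, 0)` and `(0, j)` with `1 ≤ i ≤ M`, `1 ≤ j ≤ N`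
influence the box. -/
noncomputable def unilateralLaw (K : Kernel (E × E) E) (x : Site → E) (M N : ℕ) :
    Measure (Site → E) :=
  (boxList M N).foldl (resample K) (Measure.dirac x)

/-- The law of the field with boundary conditions `x` in the
translated box `(h, l) + {1, …, m} × {1, …, n}`. -/
noncomputable def shiftedBoxLaw (K : Kernel (E × E) E) (x : Site → E) (h l m n : ℕ) :
    Measure (boxSites m n → E) :=
  (unilateralLaw K x (h + m) (l + n)).map
    fun y (p : boxSites m n) => y (p.1 + ((h : ℤ), (l : ℤ)))

/-- The law of the restriction to the finite region `Λ` of a field with law `ν`. -/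
noncomputable def marginal (ν : Measure (Site → E)) (Λ : Finset Site) : Measure (Λ → E) :=
  ν.map fun y (p : Λ) => y p.1

/-- Invariance of the law of a field under all translations. -/
def IsStationaryField (ν : Measure (Site → E)) : Prop :=
  ∀ v : Site, ν.map (fun y p => y (p + v)) = ν

/-- Total variation distance of two probability measures. -/
noncomputable def tvDistance {S : Type*} [MeasurableSpace S] (μ ν : Measure S) : ℝ :=
  ⨆ A : {A : Set S // MeasurableSet A}, |μ.real A.1 - ν.real A.1|

/-- `ν` is the law of an equilibrium field for `K`, with convergence uniform in the boundary
conditions: `ν` is stationary and, for every box, the law of the field in the translate by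
`(h, l)` of the box converges in total variation to the law under `ν`, as `h, l → ∞`, uniformly
in the boundary conditions. The kernel `K` is uniformly ergodic if such a `ν` exists. -/
def IsUniformEquilibrium (K : Kernel (E × E) E) (ν : Measure (Site → E)) : Prop :=
  IsProbabilityMeasure ν ∧ IsStationaryField ν ∧
    ∀ m n : ℕ, ∀ ε > (0 : ℝ), ∀ᶠ q : ℕ × ℕ in atTop, ∀ x : Site → E,
      tvDistance (shiftedBoxLaw K x q.1 q.2 m n) (marginal ν (boxSites m n)) < ε

end Fields

/-! ### The auxiliary i.i.d. uniform field -/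

/-- The uniform law on `(0, 1)`. -/
noncomputable def unif : Measure ℝ := volume.restrict (Set.Ioo (0 : ℝ) 1)

instance : IsProbabilityMeasure unif := ⟨by simp [unif]⟩

/-- The law of a field, indexed by `ℤ²`, of independent pairs `(U₁, U₂)` that are uniform
on `(0, 1)²`. -/
noncomputable def uniformField : Measure (Site → ℝ × ℝ) :=
  Measure.infinitePi fun _ : Site => unif.prod unif

/-! ### The coupling built from two mixture decompositions of the kernel -/

section Coupling

variable {E : Type*} [MeasurableSpace E]

/-- Functions realizing, from one uniform variable, the components of two mixture decompositions
of `K`: the decomposition `K = ρ₂ φ + (1 - ρ₂) law(f₁)` on `C²`, and the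
decomposition `K = ρ₁ K(· ∩ C) / K(C) + (1 - ρ₁) law(f₄)` everywhere. -/
structure MixtureCoupling (K : Kernel (E × E) E) (C : Set E) (φ : Measure E) (ρ₁ ρ₂ : ℝ) where
  f₀ : ℝ → E
  f₁ : ℝ × E × E → E
  f₂ : ℝ × E × E → E
  f₃ : ℝ × E × E → E
  f₄ : ℝ × E × E → E
  measurable_f₀ : Measurable f₀
  measurable_f₁ : Measurable f₁
  measurable_f₂ : Measurable f₂
  measurable_f₃ : Measurable f₃
  measurable_f₄ : Measurable f₄
  law_f₀ : unif.map f₀ = φ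
  law_f₁ : ∀ y₁ ∈ C, ∀ y₂ ∈ C, ∀ A, MeasurableSet A →
    (K (y₁, y₂)).real A =
      ρ₂ * φ.real A + (1 - ρ₂) * (unif.map fun u => f₁ (u, y₁, y₂)).real A
  law_f₁_otherwise : ∀ y₁ y₂, ¬ (y₁ ∈ C ∧ y₂ ∈ C) →
    (unif.map fun u => f₁ (u, y₁, y₂)) = K (y₁, y₂)
  law_f₂ : ∀ y₁ y₂, (unif.map fun u => f₂ (u, y₁, y₂)) = K (y₁, y₂)
  law_f₃ : ∀ y₁ y₂, ∀ A, MeasurableSet A →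
    (unif.map fun u => f₃ (u, y₁, y₂)).real A =
      (K (y₁, y₂)).real (A ∩ C) / (K (y₁, y₂)).real C
  law_f₄ : ∀ y₁ y₂, ∀ A, MeasurableSet A →
    (K (y₁, y₂)).real A =
      ρ₁ * ((K (y₁, y₂)).real (A ∩ C) / (K (y₁, y₂)).real C) +
        (1 - ρ₁) * (unif.map fun u => f₄ (u, y₁, y₂)).real A

namespace MixtureCoupling

variable {K : Kernel (E × E) E} {C : Set E} {φ : Measure E} {ρ₁ ρ₂ : ℝ}

open Classical in
/-- The coupling function used on even diagonals. -/
noncomputable def s₀ (F : MixtureCoupling K C φ ρ₁ ρ₂) (u : ℝ × ℝ) (y₁ y₂ : E) : E :=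
  if y₁ ∈ C ∧ y₂ ∈ C then
    if u.2 ∈ Set.Ioo 0 ρ₂ then F.f₀ u.1 else F.f₁ (u.1, y₁, y₂)
  else F.f₂ (u.1, y₁, y₂)

open Classical in
/-- The coupling function used on odd diagonals. -/
noncomputable def s₁ (F : MixtureCoupling K C φ ρ₁ ρ₂) (u : ℝ × ℝ) (y₁ y₂ : E) : E :=
  if u.2 ∈ Set.Ioo 0 ρ₁ then F.f₃ (u.1, y₁, y₂) else F.f₄ (u.1, y₁, y₂)

open Classical in
/-- The coupling function used at the site `p`. -/
noncomputable def s (F : MixtureCoupling K C φ ρ₁ ρ₂) (p : Site) (u : ℝ × ℝ) (y₁ y₂ : E) : E :=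
  if Even (p.1 + p.2) then F.s₀ u y₁ y₂ else F.s₁ u y₁ y₂

open Classical in
/-- `n` rounds of the recursion `X_p = s(U_p; X_{(i-1,j)}, X_{(i,j-1)})` at the sites `p` of `S`,
with `X = x` off `S`. -/
noncomputable def iter (F : MixtureCoupling K C φ ρ₁ ρ₂) (S : Set Site) (u : Site → ℝ × ℝ)
    (x : Site → E) : ℕ → Site → E
  | 0, p => x p
  | n + 1, p =>
    if p ∈ S then
      F.s p (u p) (F.iter S u x n (leftParent p)) (F.iter S u x n (belowParent p))
    else x p

/-- The field on the finite set `S` driven by `u`, with boundary conditions `x`. An increasing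
path in `S` has at most `|S|` vertices, so `|S|` rounds of the recursion solve it
(see `field_of_mem`, `field_of_notMem`). -/
noncomputable def field (F : MixtureCoupling K C φ ρ₁ ρ₂) (S : Set Site) (u : Site → ℝ × ℝ)
    (x : Site → E) : Site → E :=
  F.iter S u x S.ncard

/-- The configuration on the finite set `B` computed from the driving variables in `B` alone: the
recursion is started on the internal boundary of `B` with the values `f₀ (U₁)`, and then run on
the other sites of `B`, whose parents all lie in `B`. -/
noncomputable def upsilon (F : MixtureCoupling K C φ ρ₁ ρ₂) (B : Set Site)
    (u : Site → ℝ × ℝ) : Site → E :=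
  F.field (B \ internalBoundary B) u fun p => F.f₀ (u p).1

theorem field_of_notMem (F : MixtureCoupling K C φ ρ₁ ρ₂) (S : Set Site) (u : Site → ℝ × ℝ)
    (x : Site → E) {p : Site} (hp : p ∉ S) : F.field S u x p = x p := by
  unfold field
  cases S.ncard <;> simp [iter, hp]

theorem iter_stable (F : MixtureCoupling K C φ ρ₁ ρ₂) {S : Set Site} (hS : S.Finite)
    (u : Site → ℝ × ℝ) (x : Site → E) (n : ℕ) : ∀ p : Site,
    (S ∩ {q | q.1 + q.2 ≤ p.1 + p.2}).ncard ≤ n → F.iter S u x (n + 1) p = F.iter S u x n p := by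
  induction n with
  | zero =>
    intro p hp
    have h0 : S ∩ {q | q.1 + q.2 ≤ p.1 + p.2} = ∅ :=
      (Set.ncard_eq_zero (hS.inter_of_left _)).1 (Nat.le_zero.1 hp)
    have hpS : p ∉ S := fun h => by
      have : p ∈ S ∩ {q | q.1 + q.2 ≤ p.1 + p.2} := ⟨h, le_refl (p.1 + p.2)⟩
      simp [h0] at this
    simp [iter, hpS]
  | succ n ih =>
    intro p hp
    by_cases hpS : p ∈ S
    · have key : ∀ r : Site, r.1 + r.2 < p.1 + p.2 →
          F.iter S u x (n + 1) r = F.iter S u x n r := by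
        intro r hr
        apply ih
        have hlt : (S ∩ {q | q.1 + q.2 ≤ r.1 + r.2}).ncard <
            (S ∩ {q | q.1 + q.2 ≤ p.1 + p.2}).ncard := by
          apply Set.ncard_lt_ncard _ (hS.inter_of_left _)
          refine ⟨fun q hq => ⟨hq.1, le_trans hq.2 hr.le⟩, fun h => ?_⟩
          have : p ∈ S ∩ {q | q.1 + q.2 ≤ r.1 + r.2} := h ⟨hpS, le_refl (p.1 + p.2)⟩
          exact absurd this.2 (not_le.2 hr)
        omega
      have hl := key (leftParent p) (by simp only [leftParent]; omega)
      have hb := key (belowParent p) (by simp only [belowParent]; omega)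
      rw [iter, hl, hb]
      simp only [iter]
    · simp [iter, hpS]

/-- `field` solves the recursion. -/
theorem field_of_mem (F : MixtureCoupling K C φ ρ₁ ρ₂) {S : Set Site} (hS : S.Finite)
    (u : Site → ℝ × ℝ) (x : Site → E) {p : Site} (hp : p ∈ S) :
    F.field S u x p =
      F.s p (u p) (F.field S u x (leftParent p)) (F.field S u x (belowParent p)) := by
  have h := F.iter_stable hS u x S.ncard p (Set.ncard_le_ncard Set.inter_subset_left hS)
  unfold field
  rw [← h, iter, if_pos hp]

end MixtureCoupling

end Coupling

/-! ### The block graph (single even sites, three parents each) and the simulation region -/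

open Classical in
/-- The binary variable attached to a site `p` on an even diagonal: it is `0` when the
second uniform variables at the two parents of `p` are below `ρ₁` and the one at `p` is
below `ρ₂`. -/
noncomputable def blockVar (ρ₁ ρ₂ : ℝ) (u : Site → ℝ × ℝ) (p : Site) : ℕ :=
  if (u (leftParent p)).2 ∈ Set.Ioo 0 ρ₁ ∧ (u (belowParent p)).2 ∈ Set.Ioo 0 ρ₁ ∧
      (u p).2 ∈ Set.Ioo 0 ρ₂ then 0 else 1

/-- `p` is one of the three parents of `q` in the graph of blocks. -/
def IsBlockParent (p q : Site) : Prop :=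
  p = (q.1 - 2, q.2) ∨ p = (q.1 - 1, q.2 - 1) ∨ p = (q.1, q.2 - 2)

/-- The sites on even diagonals that are joined to a site of `T` by an open path, of positive
length, in the graph of blocks. A path is open if the block variable is `1` at each of its
vertices except possibly the first one. -/
def openCluster (ρ₁ ρ₂ : ℝ) (u : Site → ℝ × ℝ) (T : Set Site) : Set Site :=
  {p | Even (p.1 + p.2) ∧
    ∃ q ∈ T, Relation.TransGen (fun a b => IsBlockParent a b ∧ blockVar ρ₁ ρ₂ u b = 1) p q}

/-- The smallest enlargement of `Λ` whose internal boundary consists of sites on even diagonals: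
the parents of the sites of `Λ` on odd diagonals are added. It is `Λ` itself if the internal
boundary of `Λ` lies on even diagonals. -/
def evenHull (Λ : Set Site) : Set Site :=
  Λ ∪ {p | ∃ q ∈ Λ, Odd (q.1 + q.2) ∧ (p = leftParent q ∨ p = belowParent q)}

/-- The simulation region of `L` (a set whose internal boundary lies on even diagonals): `L`, the
blocks joined to its internal boundary by an open path, and the
intermediate sites (the lattice parents of the open blocks met) through which the value at an open
block is computed from its three block parents. -/
def simulationRegion (ρ₁ ρ₂ : ℝ) (u : Site → ℝ × ℝ) (L : Set Site) : Set Site :=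
  L ∪ openCluster ρ₁ ρ₂ u (internalBoundary L) ∪
    {p | ∃ q ∈ internalBoundary L ∪ openCluster ρ₁ ρ₂ u (internalBoundary L),
      blockVar ρ₁ ρ₂ u q = 1 ∧ (p = leftParent q ∨ p = belowParent q)}

/-! ### Existence of the coupling functions -/

/-! The field is built site by site from one i.i.d. family `u`, by a coupling that forgets the past.
Whatever its parents are, an odd site with second variable below `ρ₁` almost surely takes a value in
`C`; an even site with both parents in `C` and second variable below `ρ₂` takes the value `f₀ (U₁)`.
So an even site with block variable `0`, an event of probability `ρ₁² ρ₂`, regenerates, and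
otherwise it depends on the past only through its three block parents. Tracing dependence backwards
means following open paths.

The expected number of open paths of length `n` ending at a given site is at most `(3 (1 - ρ₁² ρ₂))
^ n` (`lintegral_pathCount_le`), with ratio below one. Summing over `n` bounds the cost
(`lintegral_simulationRegion_le`); Markov's inequality makes long paths unlikely
(`measure_longPath_le`).

The simulation region is bounded by regenerating sites (`internalBoundary_simulationRegion`), so
`upsilon` agrees there with every solution of the recursion that respects `C`
(`upsilon_simulationRegion_eq`). Without long paths it is therefore almost surely the field of any
large enough box, whatever the boundary conditions, and the coupling inequality `tvDistance_map_le`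
gives uniform convergence.

The coupling alternates between two kinds of diagonals, so it does not show stationarity directly.
The limit law is instead identified by uniqueness (`eq_map_equilibriumField`): all its translates
are limits of the same box laws. The same uniqueness shows that every choice of `f₀, …, f₄` yields
the same law. -/

theorem unif_map_projIcc :
    unif.map (Set.projIcc (0 : ℝ) 1 zero_le_one) = (volume : Measure unitInterval) := by
  have h : unif = (volume : Measure unitInterval).map Subtype.val := by
    rw [unitInterval.measurePreserving_coe.map_eq, unif]
    exact Measure.restrict_congr_set Ioo_ae_eq_Icc
  rw [h, Measure.map_map (by fun_prop) (by fun_prop)]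
  have : Set.projIcc (0 : ℝ) 1 zero_le_one ∘ Subtype.val = (id : unitInterval → unitInterval) := by
    ext x
    simp [Set.projIcc_val]
  rw [this, Measure.map_id]

/-- Kernels into a standard Borel space can be sampled from one uniform variable; clamping by
`projIcc` moves the sampler from `unitInterval` to all of `ℝ`. -/
theorem exists_measurable_map_unif_eq {X E : Type*} [MeasurableSpace X] [MeasurableSpace E]
    [StandardBorelSpace E] [Nonempty E] (κ : Kernel X E) [IsMarkovKernel κ] :
    ∃ f : ℝ × X → E, Measurable f ∧ ∀ x, (unif.map fun u => f (u, x)) = κ x := by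
  obtain ⟨f, hf, hfκ⟩ := κ.exists_measurable_map_eq_unitInterval
  refine ⟨fun p => f p.2 (Set.projIcc (0 : ℝ) 1 zero_le_one p.1), ?_, fun x => ?_⟩
  · exact hf.comp (measurable_snd.prodMk (by fun_prop))
  · rw [← hfκ x, ← unif_map_projIcc, Measure.map_map hf.of_uncurry_left (by fun_prop)]
    rfl

/-- If `κ` dominates `r η` over `S`, then `κ` is there a mixture of `η` and another kernel. -/
theorem exists_residual_kernel {X E : Type*} [MeasurableSpace X] [MeasurableSpace E]
    (κ η : Kernel X E) [IsMarkovKernel κ] [IsMarkovKernel η] {r : ℝ} (hr0 : 0 ≤ r) (hr1 : r ≤ 1)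
    {S : Set X} (hS : MeasurableSet S)
    (h : ∀ x ∈ S, ∀ A, MeasurableSet A → r * (η x).real A ≤ (κ x).real A) :
    ∃ ξ : Kernel X E, IsMarkovKernel ξ ∧
      (∀ x ∈ S, ∀ A, MeasurableSet A →
        (κ x).real A = r * (η x).real A + (1 - r) * (ξ x).real A) ∧
      ∀ x ∉ S, ξ x = κ x := by
  -- For `r = 1` one cannot divide by `1 - r`; domination on `A` and on its complement forces
  -- equality, and the residual has weight zero.
  rcases hr1.eq_or_lt with rfl | hr
  · refine ⟨κ, inferInstance, fun x hx A hA => ?_, fun _ _ => rfl⟩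
    have h1 := h x hx A hA
    have h2 := h x hx _ hA.compl
    rw [probReal_compl_eq_one_sub hA, probReal_compl_eq_one_sub hA] at h2
    linarith
  have hle : ∀ x ∈ S, ENNReal.ofReal r • η x ≤ κ x := fun x hx => by
    refine Measure.le_iff.2 fun A hA => ?_
    have := ENNReal.ofReal_le_ofReal (h x hx A hA)
    rw [ENNReal.ofReal_mul hr0, ofReal_measureReal, ofReal_measureReal] at this
    simpa using this
  have hfin : ∀ x, IsFiniteMeasure (ENNReal.ofReal r • η x) := fun x =>
    ⟨by simp⟩
  let g : X → Measure E := fun x => (ENNReal.ofReal (1 - r))⁻¹ • (κ x - ENNReal.ofReal r • η x)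
  have hg : ∀ x ∈ S, ∀ A, MeasurableSet A →
      g x A = (ENNReal.ofReal (1 - r))⁻¹ * (κ x A - ENNReal.ofReal r * η x A) := fun x hx A hA => by
    have := hfin x
    simp [g, Measure.sub_apply hA (hle x hx)]
  classical
  have hmeas : Measurable (S.piecewise g κ) := by
    refine Measure.measurable_of_measurable_coe _ fun A hA => ?_
    have : (fun x => S.piecewise g κ x A) = S.piecewise
        (fun x => (ENNReal.ofReal (1 - r))⁻¹ * (κ x A - ENNReal.ofReal r * η x A))
        (fun x => κ x A) := by
      ext x
      by_cases hx : x ∈ S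
      · simp [hx, hg x hx A hA]
      · simp [hx]
    rw [this]
    have h1 := κ.measurable_coe hA
    have h2 := η.measurable_coe hA
    exact Measurable.piecewise hS (by fun_prop) h1
  have hpos : 0 < 1 - r := by linarith
  have hprob : ∀ x, IsProbabilityMeasure (S.piecewise g κ x) := fun x => by
    by_cases hx : x ∈ S
    · refine ⟨?_⟩
      rw [Set.piecewise_eq_of_mem _ _ _ hx, hg x hx _ .univ]
      simp only [measure_univ, mul_one]
      rw [← ENNReal.ofReal_one, ← ENNReal.ofReal_sub _ hr0]
      exact (ENNReal.inv_mul_cancel (ENNReal.ofReal_pos.2 hpos).ne' ENNReal.ofReal_ne_top).trans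
        ENNReal.ofReal_one.symm
    · rw [Set.piecewise_eq_of_notMem _ _ _ hx]
      infer_instance
  refine ⟨⟨S.piecewise g κ, hmeas⟩, ⟨hprob⟩, fun x hx A hA => ?_, fun x hx => ?_⟩
  · have : (S.piecewise g κ x).real A = (1 - r)⁻¹ * ((κ x).real A - r * (η x).real A) := by
      have h3 : ENNReal.ofReal r * η x A ≤ κ x A := by simpa using hle x hx A
      rw [Set.piecewise_eq_of_mem _ _ _ hx, measureReal_def, hg x hx A hA, ENNReal.toReal_mul,
        ENNReal.toReal_inv, ENNReal.toReal_ofReal hpos.le,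
        ENNReal.toReal_sub_of_le h3 (measure_ne_top _ _), ENNReal.toReal_mul,
        ENNReal.toReal_ofReal hr0]
      rfl
    change _ = _ + (1 - r) * (S.piecewise g κ x).real A
    rw [this]
    field_simp
    ring
  · change S.piecewise g κ x = κ x
    exact Set.piecewise_eq_of_notMem _ _ _ hx

/-- `f₁` samples the residual of `K` after removing `ρ₂ φ` over `C ×ˢ C`, and `f₄` the residual
after removing `ρ₁ K(· | C)`. The latter is dominated because `ρ₁ ≤ K(C)`. -/
theorem nonempty_mixtureCoupling {E : Type*} [MeasurableSpace E] [StandardBorelSpace E]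
    (K : Kernel (E × E) E) [IsMarkovKernel K]
    {C : Set E} (hC : MeasurableSet C) (φ : Measure E) [IsProbabilityMeasure φ]
    {ρ₁ ρ₂ : ℝ} (hρ₁ : 0 < ρ₁) (hρ₁' : ρ₁ ≤ 1) (hρ₂ : 0 ≤ ρ₂) (hρ₂' : ρ₂ ≤ 1)
    (hKC : ∀ y₁ y₂ : E, ρ₁ ≤ (K (y₁, y₂)).real C)
    (hKφ : ∀ y₁ ∈ C, ∀ y₂ ∈ C, ∀ A : Set E, MeasurableSet A →
      ρ₂ * φ.real A ≤ (K (y₁, y₂)).real A) :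
    Nonempty (MixtureCoupling K C φ ρ₁ ρ₂) := by
  have : Nonempty E := φ.nonempty_of_neZero
  have hC0 : ∀ y, 0 < (K y).real C := fun y => hρ₁.trans_le (hKC y.1 y.2)
  let η : Kernel (E × E) E := ⟨fun y => (K y)[|C], by
    refine Measure.measurable_of_measurable_coe _ fun A hA => ?_
    simp only [cond_apply hC]
    have h1 := K.measurable_coe hC
    have h2 := K.measurable_coe (hC.inter hA)
    fun_prop⟩
  have hη : ∀ y, η y = (K y)[|C] := fun _ => rfl
  have : IsMarkovKernel η := ⟨fun y => cond_isProbabilityMeasure fun h0 => by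
    have := hC0 y
    simp [measureReal_def, h0] at this⟩
  have hηr : ∀ y A, MeasurableSet A → (η y).real A = (K y).real (A ∩ C) / (K y).real C :=
    fun y A _ => by
      rw [hη, measureReal_def, cond_apply hC, ENNReal.toReal_mul, ENNReal.toReal_inv, Set.inter_comm,
        div_eq_inv_mul]
      rfl
  obtain ⟨ξ₁, _, h₁, h₁'⟩ := exists_residual_kernel K (Kernel.const _ φ) hρ₂ hρ₂' (hC.prod hC)
    (fun y hy A hA => by simpa using hKφ y.1 hy.1 y.2 hy.2 A hA)
  obtain ⟨ξ₄, _, h₄, -⟩ := exists_residual_kernel K η hρ₁.le hρ₁' .univ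
    (fun y _ A hA => by
      rw [hηr y A hA, mul_div_assoc']
      refine (div_le_iff₀ (hC0 y)).2 ?_
      rw [mul_comm]
      exact mul_le_mul (measureReal_mono Set.inter_subset_left) (hKC y.1 y.2) hρ₁.le
        measureReal_nonneg)
  obtain ⟨f₀, hf₀, hf₀'⟩ := exists_measurable_map_unif_eq (Kernel.const Unit φ)
  obtain ⟨f₁, hf₁, hf₁'⟩ := exists_measurable_map_unif_eq ξ₁
  obtain ⟨f₂, hf₂, hf₂'⟩ := exists_measurable_map_unif_eq K
  obtain ⟨f₃, hf₃, hf₃'⟩ := exists_measurable_map_unif_eq η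
  obtain ⟨f₄, hf₄, hf₄'⟩ := exists_measurable_map_unif_eq ξ₄
  exact ⟨{
    f₀ := fun u => f₀ (u, ())
    f₁ := f₁
    f₂ := f₂
    f₃ := f₃
    f₄ := f₄
    measurable_f₀ := by fun_prop
    measurable_f₁ := hf₁
    measurable_f₂ := hf₂
    measurable_f₃ := hf₃
    measurable_f₄ := hf₄
    law_f₀ := by simpa using hf₀' ()
    law_f₁ := fun y₁ hy₁ y₂ hy₂ A hA => by
      rw [hf₁', h₁ (y₁, y₂) ⟨hy₁, hy₂⟩ A hA]
      simp
    law_f₁_otherwise := fun y₁ y₂ hy => by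
      rw [hf₁', h₁' (y₁, y₂) hy]
    law_f₂ := fun y₁ y₂ => hf₂' _
    law_f₃ := fun y₁ y₂ A hA => by rw [hf₃', hηr _ A hA]
    law_f₄ := fun y₁ y₂ A hA => by rw [hf₄', ← hηr _ A hA, ← h₄ _ trivial A hA] }⟩

/-! ### Independence of functions of disjoint sets of driving variables -/

instance : IsProbabilityMeasure uniformField := by
  unfold uniformField
  infer_instance

/-- `f` is unchanged when the coordinates outside `S` are set to zero, and that truncation is
measurable for the σ-algebra of the coordinates in `S`. -/
theorem measurable_iSup_comap_eval {γ : Type*} [MeasurableSpace γ] {f : (Site → ℝ × ℝ) → γ}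
    (hf : Measurable f) {S : Set Site} (hfS : ∀ u v, Set.EqOn u v S → f u = f v) :
    Measurable[⨆ i ∈ S, MeasurableSpace.comap (fun u : Site → ℝ × ℝ => u i) inferInstance] f := by
  classical
  have h : f = f ∘ fun u i => if i ∈ S then u i else 0 := by
    funext u
    exact hfS _ _ fun i hi => by simp [hi]
  rw [h]
  refine hf.comp (@measurable_pi_lambda _ _ _ (_) _ _ fun i => ?_)
  by_cases hi : i ∈ S
  · simp only [hi, if_true]
    exact Measurable.mono (comap_measurable _)
      (le_iSup₂_of_le i hi le_rfl) le_rfl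
  · simp only [hi, if_false]
    exact measurable_const

theorem indepFun_uniformField {γ δ : Type*} [MeasurableSpace γ] [MeasurableSpace δ]
    {f : (Site → ℝ × ℝ) → γ} {g : (Site → ℝ × ℝ) → δ} (hf : Measurable f) (hg : Measurable g)
    {S T : Set Site} (hST : Disjoint S T) (hfS : ∀ u v, Set.EqOn u v S → f u = f v)
    (hgT : ∀ u v, Set.EqOn u v T → g u = g v) : IndepFun f g uniformField := by
  have h := iIndepFun_infinitePi (P := fun _ : Site => unif.prod unif)
    (X := fun _ w => w) (fun _ => measurable_id)
  have h2 := indep_iSup_of_disjoint (fun i => (measurable_pi_apply i).comap_le) h.iIndep hST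
  exact indep_of_indep_of_le_left (indep_of_indep_of_le_right h2
    (measurable_iSup_comap_eval hg hgT).comap_le) (measurable_iSup_comap_eval hf hfS).comap_le

theorem map_eval_uniformField (p : Site) :
    uniformField.map (fun u => u p) = unif.prod unif :=
  Measure.infinitePi_map_eval _ p

/-! ### Elementary facts on the coupling functions -/

theorem unif_real_Ioo {r : ℝ} (h0 : 0 ≤ r) (h1 : r ≤ 1) : unif.real (Set.Ioo 0 r) = r := by
  have : Set.Ioo (0 : ℝ) r ∩ Set.Ioo 0 1 = Set.Ioo 0 r :=
    Set.inter_eq_left.2 (Set.Ioo_subset_Ioo_right h1)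
  rw [unif, measureReal_restrict_apply measurableSet_Ioo, this]
  simp [h0]

open Classical in
theorem map_mixture_real {E : Type*} [MeasurableSpace E] {f g : ℝ → E} (hf : Measurable f)
    (hg : Measurable g) {r : ℝ} (h0 : 0 ≤ r) (h1 : r ≤ 1) {A : Set E} (hA : MeasurableSet A) :
    ((unif.prod unif).map fun w : ℝ × ℝ => if w.2 ∈ Set.Ioo 0 r then f w.1 else g w.1).real A =
      r * (unif.map f).real A + (1 - r) * (unif.map g).real A := by
  have hm : Measurable fun w : ℝ × ℝ => if w.2 ∈ Set.Ioo 0 r then f w.1 else g w.1 :=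
    Measurable.ite (measurable_snd measurableSet_Ioo) (hf.comp measurable_fst)
      (hg.comp measurable_fst)
  have hpre : (fun w : ℝ × ℝ => if w.2 ∈ Set.Ioo 0 r then f w.1 else g w.1) ⁻¹' A =
      (f ⁻¹' A) ×ˢ Set.Ioo 0 r ∪ (g ⁻¹' A) ×ˢ (Set.Ioo 0 r)ᶜ := by
    ext w
    by_cases h : w.2 ∈ Set.Ioo 0 r <;> simp only [Set.mem_preimage, h, if_true, if_false] <;>
      simp [Set.mem_prod, -Set.mem_Ioo, h]
  rw [map_measureReal_apply hm hA, hpre, measureReal_union, measureReal_prod_prod,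
    measureReal_prod_prod, probReal_compl_eq_one_sub measurableSet_Ioo, unif_real_Ioo h0 h1,
    map_measureReal_apply hf hA, map_measureReal_apply hg hA]
  · ring
  · exact Set.disjoint_left.2 fun w h h' => h'.2 h.2
  · exact (hg hA).prod measurableSet_Ioo.compl

namespace MixtureCoupling

variable {E : Type*} [MeasurableSpace E] {K : Kernel (E × E) E} {C : Set E} {φ : Measure E}
  {ρ₁ ρ₂ : ℝ}

theorem measurable_s (F : MixtureCoupling K C φ ρ₁ ρ₂) (hC : MeasurableSet C) (p : Site) :
    Measurable fun w : (ℝ × ℝ) × E × E => F.s p w.1 w.2.1 w.2.2 := by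
  have h0 := F.measurable_f₀
  have h1 := F.measurable_f₁
  have h2 := F.measurable_f₂
  have h3 := F.measurable_f₃
  have h4 := F.measurable_f₄
  have hCC : MeasurableSet {w : (ℝ × ℝ) × E × E | w.2.1 ∈ C ∧ w.2.2 ∈ C} :=
    ((measurable_fst.comp measurable_snd) hC).inter ((measurable_snd.comp measurable_snd) hC)
  have hI : ∀ r : ℝ, MeasurableSet {w : (ℝ × ℝ) × E × E | w.1.2 ∈ Set.Ioo 0 r} := fun r =>
    (measurable_snd.comp measurable_fst) measurableSet_Ioo
  unfold s s₀ s₁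
  split_ifs
  · exact Measurable.ite hCC (Measurable.ite (hI _) (by fun_prop) (by fun_prop)) (by fun_prop)
  · exact Measurable.ite (hI _) (by fun_prop) (by fun_prop)

/-- At every site, the coupling function realizes the kernel. -/
theorem map_s [IsMarkovKernel K] (F : MixtureCoupling K C φ ρ₁ ρ₂) (hC : MeasurableSet C)
    (h10 : 0 ≤ ρ₁) (h11 : ρ₁ ≤ 1) (h20 : 0 ≤ ρ₂) (h21 : ρ₂ ≤ 1) (p : Site) (y : E × E) :
    ((unif.prod unif).map fun w => F.s p w y.1 y.2) = K y := by
  have h0 := F.measurable_f₀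
  have h1 := F.measurable_f₁
  have h2 := F.measurable_f₂
  have h3 := F.measurable_f₃
  have h4 := F.measurable_f₄
  have hm : Measurable fun w => F.s p w y.1 y.2 :=
    (F.measurable_s hC p).comp (measurable_id.prodMk measurable_const)
  have := Measure.isProbabilityMeasure_map (μ := unif.prod unif) hm.aemeasurable
  refine Measure.ext fun A hA => ?_
  rw [← measureReal_eq_measureReal_iff]
  unfold s s₀ s₁
  split_ifs with hp hy
  · rw [map_mixture_real (g := fun u => F.f₁ (u, y.1, y.2)) h0 (by fun_prop) h20 h21 hA, F.law_f₀, F.law_f₁ _ hy.1 _ hy.2 A hA]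
  · have hf : Measurable fun u => F.f₂ (u, y.1, y.2) := by fun_prop
    have h := (measurePreserving_fst (μ := unif) (ν := unif)).map_eq
    rw [← F.law_f₂ y.1 y.2, ← h, Measure.map_map hf measurable_fst, h]
    rfl
  · rw [map_mixture_real (f := fun u => F.f₃ (u, y.1, y.2)) (g := fun u => F.f₄ (u, y.1, y.2))
      (by fun_prop) (by fun_prop) h10 h11 hA, F.law_f₃ _ _ A hA, F.law_f₄ y.1 y.2 A hA]

/-- The law of `f₃` gives `C` mass one. Membership is only almost sure, with an exceptional set that
may depend on `y`. -/
theorem s_mem_of_lt [IsMarkovKernel K] (F : MixtureCoupling K C φ ρ₁ ρ₂) (hC : MeasurableSet C)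
    (hKC : ∀ y, 0 < (K y).real C) {p : Site} (hp : ¬ Even (p.1 + p.2)) (y : E × E) :
    ∀ᵐ w ∂unif.prod unif, w.2 ∈ Set.Ioo 0 ρ₁ → F.s p w y.1 y.2 ∈ C := by
  have h3 := F.measurable_f₃
  have hf : Measurable fun u => F.f₃ (u, y.1, y.2) := by fun_prop
  have h := F.law_f₃ y.1 y.2 C hC
  rw [Set.inter_self, div_self (hKC y).ne', map_measureReal_apply hf hC] at h
  have h1 : ∀ᵐ u ∂unif, F.f₃ (u, y.1, y.2) ∈ C := by
    refine (mem_ae_iff_prob_eq_one (hf hC)).2 ?_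
    rw [measureReal_def] at h
    exact (ENNReal.toReal_eq_one_iff _).1 h
  filter_upwards [Measure.quasiMeasurePreserving_fst.ae h1] with w hw hw2
  simpa [s, s₁, hp, -Set.mem_Ioo, hw2] using hw

/-! ### The sequential construction -/

/-- The recursion, run once through the list of sites `L`, from the initial configuration `x`. -/
noncomputable def seqField (F : MixtureCoupling K C φ ρ₁ ρ₂) (L : List Site) (x : Site → E)
    (u : Site → ℝ × ℝ) : Site → E :=
  L.foldl (fun X p => Function.update X p (F.s p (u p) (X (leftParent p)) (X (belowParent p)))) x

variable (F : MixtureCoupling K C φ ρ₁ ρ₂)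

theorem seqField_nil (x : Site → E) (u : Site → ℝ × ℝ) : F.seqField [] x u = x := rfl

theorem seqField_concat (L : List Site) (q : Site) (x : Site → E) (u : Site → ℝ × ℝ) :
    F.seqField (L ++ [q]) x u = Function.update (F.seqField L x u) q
      (F.s q (u q) (F.seqField L x u (leftParent q)) (F.seqField L x u (belowParent q))) := by
  simp [seqField]

theorem measurable_s_parents (hC : MeasurableSet C) (q : Site) :
    Measurable fun w : (Site → E) × (ℝ × ℝ) =>
      F.s q w.2 (w.1 (leftParent q)) (w.1 (belowParent q)) :=
  (F.measurable_s hC q).comp (g := fun w : (ℝ × ℝ) × E × E => F.s q w.1 w.2.1 w.2.2)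
    (f := fun w : (Site → E) × (ℝ × ℝ) => (w.2, w.1 (leftParent q), w.1 (belowParent q)))
    (by fun_prop)

theorem measurable_update_s (hC : MeasurableSet C) (q : Site) :
    Measurable fun w : (Site → E) × (ℝ × ℝ) =>
      Function.update w.1 q (F.s q w.2 (w.1 (leftParent q)) (w.1 (belowParent q))) :=
  measurable_update'.comp (measurable_fst.prodMk (F.measurable_s_parents hC q))

theorem measurable_seqField (hC : MeasurableSet C) (L : List Site) (x : Site → E) :
    Measurable (F.seqField L x) := by
  induction L using List.reverseRecOn with
  | nil => exact measurable_const
  | append_singleton L q ih =>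
    simp only [funext (F.seqField_concat L q x)]
    exact (F.measurable_update_s hC q).comp (ih.prodMk (measurable_pi_apply q))

theorem seqField_congr (L : List Site) (x : Site → E) {u v : Site → ℝ × ℝ}
    (h : ∀ p ∈ L, u p = v p) : F.seqField L x u = F.seqField L x v := by
  induction L using List.reverseRecOn with
  | nil => rfl
  | append_singleton L q ih =>
    rw [seqField_concat, seqField_concat, ih fun p hp => h p (by simp [hp]), h q (by simp)]

/-- The field built along `L` reads only the variables of `L`, so the one at a new site is
independent of it. -/
theorem map_seqField_prod (hC : MeasurableSet C) (L : List Site) (x : Site → E) {q : Site}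
    (hq : q ∉ L) :
    uniformField.map (fun u => (F.seqField L x u, u q)) =
      (uniformField.map (F.seqField L x)).prod (unif.prod unif) := by
  rw [← map_eval_uniformField q]
  refine (indepFun_iff_map_prod_eq_prod_map_map (F.measurable_seqField hC L x).aemeasurable
    (measurable_pi_apply q).aemeasurable).1 ?_
  refine indepFun_uniformField (S := {p | p ∈ L}) (T := {q}) (F.measurable_seqField hC L x)
    (measurable_pi_apply q) (by simpa using hq) (fun u v h => F.seqField_congr L x h)
    (fun u v h => h rfl)

/-- The sequential construction driven by `u` realizes the law obtained by resampling. -/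
theorem map_seqField [IsMarkovKernel K] (hC : MeasurableSet C)
    (h10 : 0 ≤ ρ₁) (h11 : ρ₁ ≤ 1) (h20 : 0 ≤ ρ₂) (h21 : ρ₂ ≤ 1) {L : List Site} (hL : L.Nodup)
    (x : Site → E) :
    uniformField.map (F.seqField L x) = L.foldl (resample K) (Measure.dirac x) := by
  induction L using List.reverseRecOn with
  | nil =>
    simp only [funext (F.seqField_nil x), List.foldl_nil]
    rw [Measure.map_const]
    simp
  | append_singleton L q ih =>
    have hL' := List.nodup_append.1 hL
    have hq : q ∉ L := fun h => hL'.2.2 q h q (by simp) rfl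
    have hup := F.measurable_update_s hC q
    rw [List.foldl_append, List.foldl_cons, List.foldl_nil, ← ih hL'.1]
    simp only [funext (F.seqField_concat L q x)]
    have h := congrArg (Measure.map fun w : (Site → E) × (ℝ × ℝ) =>
      Function.update w.1 q (F.s q w.2 (w.1 (leftParent q)) (w.1 (belowParent q))))
      (F.map_seqField_prod hC L x hq)
    rw [Measure.map_map hup ((F.measurable_seqField hC L x).prodMk (measurable_pi_apply q))] at h
    refine h.trans ?_
    -- By `map_s`, redrawing from `K` is the same as applying `s` to a fresh pair of uniforms.
    have hk : ∀ y : Site → E,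
        (K (y (leftParent q), y (belowParent q))).map (Function.update y q) =
          (unif.prod unif).map fun w => Function.update y q
            (F.s q w (y (leftParent q)) (y (belowParent q))) := fun y => by
      have hms : Measurable fun w => F.s q w (y (leftParent q)) (y (belowParent q)) :=
        (F.measurable_s_parents hC q).comp measurable_prodMk_left
      rw [← F.map_s hC h10 h11 h20 h21 q, Measure.map_map (measurable_update y) hms]
      rfl
    have hkA : ∀ (y : Site → E) {A : Set (Site → E)}, MeasurableSet A →
        (K (y (leftParent q), y (belowParent q))).map (Function.update y q) A =
          (unif.prod unif) (Prod.mk y ⁻¹' ((fun w : (Site → E) × (ℝ × ℝ) =>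
            Function.update w.1 q (F.s q w.2 (w.1 (leftParent q)) (w.1 (belowParent q)))) ⁻¹' A)) :=
      fun y A hA => by
        rw [hk]
        exact Measure.map_apply (hup.comp measurable_prodMk_left) hA
    refine Measure.ext fun A hA => ?_
    rw [Measure.map_apply hup hA, Measure.prod_apply (hup hA), resample,
      Measure.bind_apply hA]
    · exact lintegral_congr fun y => (hkA y hA).symm
    · refine (Measure.measurable_of_measurable_coe _ fun B hB => ?_).aemeasurable
      simp only [hkA _ hB]
      exact measurable_measure_prodMk_left (hup hB)

/-- Almost surely, the field lies in `C` at the odd sites whose second driving variable is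
below `ρ₁`. -/
theorem ae_seqField_mem [IsMarkovKernel K] (hC : MeasurableSet C)
    (hKC : ∀ y, 0 < (K y).real C) {L : List Site} (hL : L.Nodup) (x : Site → E) :
    ∀ᵐ u ∂uniformField, ∀ p ∈ L, ¬ Even (p.1 + p.2) → (u p).2 ∈ Set.Ioo 0 ρ₁ →
      F.seqField L x u p ∈ C := by
  induction L using List.reverseRecOn with
  | nil => simp
  | append_singleton L q ih =>
    have hL' := List.nodup_append.1 hL
    have hq : q ∉ L := fun h => hL'.2.2 q h q (by simp) rfl
    have hnew : ∀ᵐ u ∂uniformField, ¬ Even (q.1 + q.2) → (u q).2 ∈ Set.Ioo 0 ρ₁ →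
        F.s q (u q) (F.seqField L x u (leftParent q)) (F.seqField L x u (belowParent q)) ∈ C := by
      by_cases hpar : Even (q.1 + q.2)
      · exact ae_of_all _ fun u h => absurd hpar h
      have hms := F.measurable_s_parents hC q
      -- The null set of `s_mem_of_lt` varies with the parent values; independence of `u q` from the
      -- past lets Fubini combine these sections.
      have hae : ∀ᵐ w ∂uniformField.map (fun u => (F.seqField L x u, u q)),
          w.2.2 ∈ Set.Ioo 0 ρ₁ → F.s q w.2 (w.1 (leftParent q)) (w.1 (belowParent q)) ∈ C := by
        rw [F.map_seqField_prod hC L x hq]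
        refine (Measure.ae_prod_iff_ae_ae ?_).2
          (ae_of_all _ fun y => F.s_mem_of_lt hC hKC hpar (_, _))
        exact (((measurable_snd.comp measurable_snd) measurableSet_Ioo).imp (hms hC) :)
      filter_upwards [ae_of_ae_map ((F.measurable_seqField hC L x).prodMk
        (measurable_pi_apply q)).aemeasurable hae] with u hu _ h2 using hu h2
    filter_upwards [ih hL'.1, hnew] with u hu hu' p hp hpar hp2
    rw [seqField_concat]
    by_cases hpq : p = q
    · subst hpq
      rw [Function.update_self]
      exact hu' hpar hp2
    · rw [Function.update_of_ne hpq]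
      exact hu p (by simpa [hpq] using hp) hpar hp2

/-- If no site of the list is preceded by a child, the construction solves the recursion. -/
theorem seqField_of_mem {L : List Site} (hL : L.Nodup)
    (hL' : L.Pairwise fun p q => q ≠ leftParent p ∧ q ≠ belowParent p)
    (x : Site → E) (u : Site → ℝ × ℝ) {p : Site} (hp : p ∈ L) :
    F.seqField L x u p =
      F.s p (u p) (F.seqField L x u (leftParent p)) (F.seqField L x u (belowParent p)) := by
  induction L using List.reverseRecOn with
  | nil => simp at hp
  | append_singleton L q ih =>
    have h1 := List.nodup_append.1 hL
    have h2 := List.pairwise_append.1 hL'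
    have hq : q ∉ L := fun h => h1.2.2 q h q (by simp) rfl
    rw [seqField_concat]
    by_cases hpq : p = q
    · subst hpq
      rw [Function.update_self, Function.update_of_ne, Function.update_of_ne]
      · simp [belowParent, Prod.ext_iff]
      · simp [leftParent, Prod.ext_iff]
    · have hpL : p ∈ L := by simpa [hpq] using hp
      have h3 := h2.2.2 p hpL q (by simp)
      rw [Function.update_of_ne hpq, Function.update_of_ne h3.1.symm,
        Function.update_of_ne h3.2.symm]
      exact ih h1.1 h2.1 hpL

end MixtureCoupling

/-! ### Open paths in the block graph -/

section OpenPaths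

variable (ρ₁ ρ₂ : ℝ) (u : Site → ℝ × ℝ)

/-- The first vertices of the open paths of length `n` that end at `q`. -/
def reach : ℕ → Site → Set Site
  | 0, q => {q}
  | n + 1, q => {p | blockVar ρ₁ ρ₂ u q = 1 ∧ ∃ r, IsBlockParent r q ∧ p ∈ reach n r}

/-- The number of open paths of length `n` that end at `q`. -/
noncomputable def pathCount : ℕ → Site → ℝ≥0∞
  | 0, _ => 1
  | n + 1, q => (blockVar ρ₁ ρ₂ u q : ℝ≥0∞) * (pathCount n (q.1 - 2, q.2) +
      pathCount n (q.1 - 1, q.2 - 1) + pathCount n (q.1, q.2 - 2))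

theorem blockVar_eq_zero_or_one (p : Site) : blockVar ρ₁ ρ₂ u p = 0 ∨ blockVar ρ₁ ρ₂ u p = 1 := by
  unfold blockVar
  split_ifs <;> simp

/-- Passing to the counting measure makes the union bounds for measures available for cardinalities.
-/
theorem encard_eq_count (s : Set Site) : (s.encard : ℝ≥0∞) = Measure.count s :=
  (Measure.count_apply (Set.to_countable s).measurableSet).symm

/-- Only an inequality, since several open paths may share their first vertex. -/
theorem count_reach_le (n : ℕ) (q : Site) :
    Measure.count (reach ρ₁ ρ₂ u n q) ≤ pathCount ρ₁ ρ₂ u n q := by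
  induction n generalizing q with
  | zero => simp [reach, pathCount]
  | succ n ih =>
    rcases blockVar_eq_zero_or_one ρ₁ ρ₂ u q with h | h
    · simp [reach, h]
    · have : reach ρ₁ ρ₂ u (n + 1) q ⊆ (reach ρ₁ ρ₂ u n (q.1 - 2, q.2) ∪
          reach ρ₁ ρ₂ u n (q.1 - 1, q.2 - 1)) ∪ reach ρ₁ ρ₂ u n (q.1, q.2 - 2) := by
        rintro p ⟨-, r, rfl | rfl | rfl, hp⟩
        · exact Or.inl (Or.inl hp)
        · exact Or.inl (Or.inr hp)
        · exact Or.inr hp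
      simp only [pathCount, h, Nat.cast_one, one_mul]
      refine (measure_mono this).trans ((measure_union_le _ _).trans (add_le_add
        ((measure_union_le _ _).trans (add_le_add (ih _) (ih _))) (ih _)))

theorem reach_eq_empty_of_pathCount {n : ℕ} {q : Site} (h : pathCount ρ₁ ρ₂ u n q < 1) :
    reach ρ₁ ρ₂ u n q = ∅ := by
  have := (count_reach_le ρ₁ ρ₂ u n q).trans_lt h
  rw [← encard_eq_count] at this
  exact Set.encard_eq_zero.1 (Order.lt_one_iff.1 (by exact_mod_cast this))

/-- Dropping the first vertex of an open path leaves an open path with the same end. -/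
theorem reach_succ_eq_empty {n : ℕ} {q : Site} (h : reach ρ₁ ρ₂ u n q = ∅) :
    reach ρ₁ ρ₂ u (n + 1) q = ∅ := by
  induction n generalizing q with
  | zero => simp [reach] at h
  | succ n ih =>
    refine Set.eq_empty_of_forall_notMem fun p hp => ?_
    obtain ⟨h1, r, hr, hp⟩ := hp
    have : reach ρ₁ ρ₂ u n r = ∅ := Set.eq_empty_of_forall_notMem fun p' hp' => by
      have : p' ∈ reach ρ₁ ρ₂ u (n + 1) q := ⟨h1, r, hr, hp'⟩
      simp [h] at this
    simp [ih this] at hp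

theorem reach_eq_empty_of_le {m n : ℕ} (hmn : m ≤ n) {q : Site} (h : reach ρ₁ ρ₂ u m q = ∅) :
    reach ρ₁ ρ₂ u n q = ∅ := by
  induction n, hmn using Nat.le_induction with
  | base => exact h
  | succ n _ ih => exact reach_succ_eq_empty ρ₁ ρ₂ u ih

variable {ρ₁ ρ₂ u}

theorem bounds_of_mem_reach {n : ℕ} {p q : Site} (h : p ∈ reach ρ₁ ρ₂ u n q) :
    p.1 ≤ q.1 ∧ q.1 ≤ p.1 + 2 * n ∧ p.2 ≤ q.2 ∧ q.2 ≤ p.2 + 2 * n := by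
  induction n generalizing q with
  | zero =>
    obtain rfl : p = q := h
    simp
  | succ n ih =>
    obtain ⟨-, r, hr, hp⟩ := h
    have := ih hp
    push_cast
    rcases hr with rfl | rfl | rfl <;> simp only at this <;> omega

theorem exists_mem_reach_of_mem_openCluster {T : Set Site} {p : Site}
    (h : p ∈ openCluster ρ₁ ρ₂ u T) : ∃ q ∈ T, ∃ n, p ∈ reach ρ₁ ρ₂ u n q := by
  obtain ⟨-, q, hq, hpq⟩ := h
  refine ⟨q, hq, ?_⟩
  clear hq
  induction hpq with
  | single h => exact ⟨1, h.2, p, h.1, rfl⟩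
  | tail _ h ih =>
    obtain ⟨n, hn⟩ := ih
    exact ⟨n + 1, h.2, _, h.1, hn⟩

end OpenPaths

/-! ### The expected number of open paths -/

theorem measurable_blockVar (ρ₁ ρ₂ : ℝ) (q : Site) :
    Measurable fun u : Site → ℝ × ℝ => (blockVar ρ₁ ρ₂ u q : ℝ≥0∞) := by
  have h : ∀ (p : Site) (r : ℝ), MeasurableSet {u : Site → ℝ × ℝ | (u p).2 ∈ Set.Ioo 0 r} :=
    fun p r => (measurable_snd.comp (measurable_pi_apply p)) measurableSet_Ioo
  unfold blockVar
  simp only [Nat.cast_ite]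
  exact Measurable.ite ((h _ _).inter ((h _ _).inter (h _ _))) measurable_const measurable_const

theorem measurable_pathCount (ρ₁ ρ₂ : ℝ) (n : ℕ) (q : Site) :
    Measurable fun u => pathCount ρ₁ ρ₂ u n q := by
  induction n generalizing q with
  | zero => exact measurable_const
  | succ n ih => exact (measurable_blockVar ρ₁ ρ₂ q).mul (((ih _).add (ih _)).add (ih _))

theorem pathCount_congr {ρ₁ ρ₂ : ℝ} {u v : Site → ℝ × ℝ} {n : ℕ} {q : Site}
    (h : Set.EqOn u v {p | p.1 + p.2 ≤ q.1 + q.2}) :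
    pathCount ρ₁ ρ₂ u n q = pathCount ρ₁ ρ₂ v n q := by
  induction n generalizing q with
  | zero => rfl
  | succ n ih =>
    have h1 : blockVar ρ₁ ρ₂ u q = blockVar ρ₁ ρ₂ v q := by
      unfold blockVar
      rw [h (x := q) (by simp), h (x := leftParent q) (by simp [leftParent]),
        h (x := belowParent q) (by simp [belowParent])]
    simp only [pathCount]
    rw [h1, ih, ih, ih] <;> refine h.mono fun p hp => ?_ <;>
      simp only [Set.mem_ofPred_eq] at hp ⊢ <;> omega

theorem unif_Ioo {r : ℝ} (h0 : 0 ≤ r) (h1 : r ≤ 1) : unif (Set.Ioo 0 r) = ENNReal.ofReal r := by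
  rw [← ofReal_measureReal, unif_real_Ioo h0 h1]

theorem lintegral_blockVar {ρ₁ ρ₂ : ℝ} (h10 : 0 ≤ ρ₁) (h11 : ρ₁ ≤ 1) (h20 : 0 ≤ ρ₂)
    (h21 : ρ₂ ≤ 1) (q : Site) :
    ∫⁻ u, (blockVar ρ₁ ρ₂ u q : ℝ≥0∞) ∂uniformField = ENNReal.ofReal (1 - ρ₁ ^ 2 * ρ₂) := by
  -- With threshold `ρ₂` at `q` and `ρ₁` elsewhere, the event that the block variable vanishes is a
  -- cylinder over three distinct sites.
  let t : Site → Set (ℝ × ℝ) := fun p => Set.univ ×ˢ Set.Ioo 0 (if p = q then ρ₂ else ρ₁)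
  have hl : leftParent q ≠ q := by simp [leftParent, Prod.ext_iff]
  have hb : belowParent q ≠ q := by simp [belowParent, Prod.ext_iff]
  have hlb : leftParent q ≠ belowParent q := by simp [leftParent, belowParent, Prod.ext_iff]
  have ht : ∀ p, MeasurableSet (t p) := fun p => MeasurableSet.univ.prod measurableSet_Ioo
  set G := Set.pi (({leftParent q, belowParent q, q} : Finset Site) : Set Site) t with hG
  have hGm : MeasurableSet G := MeasurableSet.pi (Finset.countable_toSet _) fun p _ => ht p
  have hGr : uniformField G = ENNReal.ofReal (ρ₁ ^ 2 * ρ₂) := by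
    rw [hG, uniformField, Measure.infinitePi_pi _ fun p _ => ht p,
      Finset.prod_insert (by simp [hl, hlb]), Finset.prod_insert (by simp [hb]),
      Finset.prod_singleton]
    simp only [t, Measure.prod_prod, measure_univ, one_mul, hl, hb, if_true, if_false]
    rw [unif_Ioo h10 h11, unif_Ioo h20 h21, ← ENNReal.ofReal_mul h10, ← ENNReal.ofReal_mul h10]
    ring_nf
  have hW : (fun u => (blockVar ρ₁ ρ₂ u q : ℝ≥0∞)) = Gᶜ.indicator fun _ => 1 := by
    funext u
    have : u ∈ G ↔ ((u (leftParent q)).2 ∈ Set.Ioo 0 ρ₁ ∧ (u (belowParent q)).2 ∈ Set.Ioo 0 ρ₁ ∧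
        (u q).2 ∈ Set.Ioo 0 ρ₂) := by
      simp [hG, t, hl, hb, -Set.mem_Ioo]
    by_cases hu : u ∈ G
    · rw [blockVar, if_pos (this.1 hu)]
      simp [hu]
    · rw [blockVar, if_neg fun h => hu (this.2 h)]
      simp [hu]
  rw [hW, lintegral_indicator_const hGm.compl, one_mul, prob_compl_eq_one_sub hGm, hGr,
    ENNReal.ofReal_sub _ (by positivity), ENNReal.ofReal_one]

/-- The block variable at `q` reads the diagonal of `q` and the one before it, whereas the counts at
the block parents read only earlier diagonals. The two are independent, so each step costs a factor
`3 (1 - ρ₁² ρ₂)`. Block variables on one diagonal may be dependent: the three counts are simply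
added. -/
theorem lintegral_pathCount_le {ρ₁ ρ₂ : ℝ} (h10 : 0 ≤ ρ₁) (h11 : ρ₁ ≤ 1) (h20 : 0 ≤ ρ₂)
    (h21 : ρ₂ ≤ 1) (n : ℕ) (q : Site) :
    ∫⁻ u, pathCount ρ₁ ρ₂ u n q ∂uniformField ≤ (3 * ENNReal.ofReal (1 - ρ₁ ^ 2 * ρ₂)) ^ n := by
  induction n generalizing q with
  | zero => simp [pathCount]
  | succ n ih =>
    have hm := measurable_pathCount ρ₁ ρ₂ n
    have hm3 : Measurable fun u => pathCount ρ₁ ρ₂ u n (q.1 - 2, q.2) +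
        pathCount ρ₁ ρ₂ u n (q.1 - 1, q.2 - 1) + pathCount ρ₁ ρ₂ u n (q.1, q.2 - 2) :=
      ((hm _).add (hm _)).add (hm _)
    have hind : IndepFun (fun u => (blockVar ρ₁ ρ₂ u q : ℝ≥0∞)) (fun u =>
        pathCount ρ₁ ρ₂ u n (q.1 - 2, q.2) + pathCount ρ₁ ρ₂ u n (q.1 - 1, q.2 - 1) +
          pathCount ρ₁ ρ₂ u n (q.1, q.2 - 2)) uniformField := by
      refine indepFun_uniformField (S := {leftParent q, belowParent q, q})
        (T := {p | p.1 + p.2 ≤ q.1 + q.2 - 2}) (measurable_blockVar ρ₁ ρ₂ q) hm3 ?_ ?_ ?_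
      · simp [Set.disjoint_left, leftParent, belowParent]
        omega
      · intro u v h
        simp only [blockVar]
        rw [h (x := leftParent q) (by simp), h (x := belowParent q) (by simp), h (x := q) (by simp)]
      · intro u v h
        rw [pathCount_congr (u := u) (v := v), pathCount_congr (u := u) (v := v),
          pathCount_congr (u := u) (v := v)] <;> refine h.mono fun p hp => ?_ <;>
          simp only [Set.mem_ofPred_eq] at hp ⊢ <;> omega
    have := lintegral_mul_eq_lintegral_mul_lintegral_of_indepFun (measurable_blockVar ρ₁ ρ₂ q) hm3
      hind
    simp only [pathCount]
    refine this.le.trans ?_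
    rw [lintegral_blockVar h10 h11 h20 h21, lintegral_add_right _ (hm _),
      lintegral_add_left (hm _)]
    calc _ ≤ ENNReal.ofReal (1 - ρ₁ ^ 2 * ρ₂) * ((3 * ENNReal.ofReal (1 - ρ₁ ^ 2 * ρ₂)) ^ n +
          (3 * ENNReal.ofReal (1 - ρ₁ ^ 2 * ρ₂)) ^ n +
          (3 * ENNReal.ofReal (1 - ρ₁ ^ 2 * ρ₂)) ^ n) := by gcongr <;> exact ih _
      _ = _ := by ring

/-! ### Geometry of the simulation region -/

theorem not_even_leftParent {p : Site} (h : Even (p.1 + p.2)) :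
    ¬ Even ((leftParent p).1 + (leftParent p).2) := by
  simp only [leftParent]
  grind

theorem not_even_belowParent {p : Site} (h : Even (p.1 + p.2)) :
    ¬ Even ((belowParent p).1 + (belowParent p).2) := by
  simp only [belowParent]
  grind

/-- The four lattice grandparents of a site are its three block parents, the diagonal one being met
twice. Hence an intermediate site of the simulation region has both parents in the region. -/
theorem isBlockParent_grandparents (q : Site) :
    (IsBlockParent (leftParent (leftParent q)) q ∧ IsBlockParent (belowParent (leftParent q)) q) ∧
      IsBlockParent (leftParent (belowParent q)) q ∧
        IsBlockParent (belowParent (belowParent q)) q := by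
  refine ⟨⟨Or.inl (Prod.ext ?_ ?_), Or.inr (Or.inl (Prod.ext ?_ ?_))⟩,
    Or.inr (Or.inl (Prod.ext ?_ ?_)), Or.inr (Or.inr (Prod.ext ?_ ?_))⟩ <;>
    simp only [leftParent, belowParent] <;> omega

/-- The sites added to `Λ` are even, so an odd site of the hull comes from `Λ` and its parents were
added. -/
theorem parents_mem_evenHull {Λ : Set Site} {p : Site} (hp : p ∈ evenHull Λ)
    (hpar : ¬ Even (p.1 + p.2)) : leftParent p ∈ evenHull Λ ∧ belowParent p ∈ evenHull Λ := by
  have hpΛ : p ∈ Λ := by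
    rcases hp with hp | ⟨q, hq, hodd, rfl | rfl⟩
    · exact hp
    · exact absurd (by simp only [leftParent]; grind) hpar
    · exact absurd (by simp only [belowParent]; grind) hpar
  have := Int.not_even_iff_odd.1 hpar
  exact ⟨Or.inr ⟨p, hpΛ, this, Or.inl rfl⟩, Or.inr ⟨p, hpΛ, this, Or.inr rfl⟩⟩

theorem even_of_mem_internalBoundary_evenHull {Λ : Set Site} {p : Site}
    (hp : p ∈ internalBoundary (evenHull Λ)) : Even (p.1 + p.2) := by
  by_contra h
  obtain ⟨h1, h2⟩ := parents_mem_evenHull hp.1 h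
  exact hp.2.elim (fun h => h h1) fun h => h h2

section Region

variable {ρ₁ ρ₂ : ℝ} {u : Site → ℝ × ℝ} {Λ : Set Site}

/-- The boundary sites of the simulation region are even and have block variable `0`. -/
theorem internalBoundary_simulationRegion {p : Site}
    (hp : p ∈ internalBoundary (simulationRegion ρ₁ ρ₂ u (evenHull Λ))) :
    Even (p.1 + p.2) ∧ blockVar ρ₁ ρ₂ u p = 0 := by
  set L := evenHull Λ
  set σ := openCluster ρ₁ ρ₂ u (internalBoundary L) with hσ
  set D := simulationRegion ρ₁ ρ₂ u L with hD
  have hLD : L ⊆ D := fun p hp => Or.inl (Or.inl hp)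
  have hσD : σ ⊆ D := fun p hp => Or.inl (Or.inr hp)
  have heven : ∀ q ∈ internalBoundary L ∪ σ, Even (q.1 + q.2) := fun q hq =>
    hq.elim even_of_mem_internalBoundary_evenHull fun h => h.1
  -- An open path starting at `q` can be prolonged backwards from `q` as soon as `q` itself is open.
  have hblock : ∀ q ∈ internalBoundary L ∪ σ, blockVar ρ₁ ρ₂ u q = 1 →
      ∀ r, IsBlockParent r q → r ∈ D := fun q hq hW r hr => by
    have hre : Even (r.1 + r.2) := by
      have := heven q hq
      rcases hr with rfl | rfl | rfl <;> simp only <;> grind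
    rcases hq with hq | ⟨-, t, ht, hqt⟩
    · exact hσD ⟨hre, q, hq, .single ⟨hr, hW⟩⟩
    · exact hσD ⟨hre, t, ht, .head ⟨hr, hW⟩ hqt⟩
  have hpar : ∀ q ∈ internalBoundary L ∪ σ, blockVar ρ₁ ρ₂ u q = 1 →
      leftParent q ∈ D ∧ belowParent q ∈ D := fun q hq hW =>
    ⟨Or.inr ⟨q, hq, hW, Or.inl rfl⟩, Or.inr ⟨q, hq, hW, Or.inr rfl⟩⟩
  suffices h : Even (p.1 + p.2) ∧ blockVar ρ₁ ρ₂ u p = 0 ∨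
      (leftParent p ∈ D ∧ belowParent p ∈ D) from
    h.resolve_right fun h => hp.2.elim (fun h' => h' h.1) fun h' => h' h.2
  rcases blockVar_eq_zero_or_one ρ₁ ρ₂ u p with hW | hW <;>
    rcases hp.1 with (hpL | hpσ) | ⟨q, hq, hWq, hpq⟩
  · by_cases he : Even (p.1 + p.2)
    · exact Or.inl ⟨he, hW⟩
    · have := parents_mem_evenHull hpL he
      exact Or.inr ⟨hLD this.1, hLD this.2⟩
  · exact Or.inl ⟨hpσ.1, hW⟩
  · right
    rcases hpq with rfl | rfl
    · exact (isBlockParent_grandparents q).1.imp (hblock q hq hWq _) (hblock q hq hWq _)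
    · exact (isBlockParent_grandparents q).2.imp (hblock q hq hWq _) (hblock q hq hWq _)
  · right
    by_cases hb : p ∈ internalBoundary L
    · exact hpar p (Or.inl hb) hW
    · have : leftParent p ∈ L ∧ belowParent p ∈ L := by
        by_contra h
        exact hb ⟨hpL, by tauto⟩
      exact ⟨hLD this.1, hLD this.2⟩
  · exact Or.inr (hpar p (Or.inr hpσ) hW)
  · right
    rcases hpq with rfl | rfl
    · exact (isBlockParent_grandparents q).1.imp (hblock q hq hWq _) (hblock q hq hWq _)
    · exact (isBlockParent_grandparents q).2.imp (hblock q hq hWq _) (hblock q hq hWq _)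

theorem subset_simulationRegion : Λ ⊆ simulationRegion ρ₁ ρ₂ u (evenHull Λ) :=
  fun _ hp => Or.inl (Or.inl (Or.inl hp))

theorem bounds_of_mem_evenHull {p : Site} (hp : p ∈ evenHull Λ) :
    ∃ q ∈ Λ, p.1 ≤ q.1 ∧ q.1 ≤ p.1 + 1 ∧ p.2 ≤ q.2 ∧ q.2 ≤ p.2 + 1 := by
  rcases hp with hp | ⟨q, hq, -, rfl | rfl⟩
  · exact ⟨p, hp, by omega⟩
  · exact ⟨q, hq, by simp [leftParent]⟩
  · exact ⟨q, hq, by simp [belowParent]⟩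

/-- If no open path of length `N` ends on the boundary, then the simulation region
is at distance at most `2 N + 2` from `Λ`. -/
theorem bounds_of_mem_simulationRegion {N : ℕ}
    (hN : ∀ q ∈ internalBoundary (evenHull Λ), pathCount ρ₁ ρ₂ u N q < 1) {p : Site}
    (hp : p ∈ simulationRegion ρ₁ ρ₂ u (evenHull Λ)) :
    ∃ q ∈ Λ, p.1 ≤ q.1 ∧ q.1 ≤ p.1 + 2 * N + 2 ∧ p.2 ≤ q.2 ∧ q.2 ≤ p.2 + 2 * N + 2 := by
  -- The hull costs one unit per coordinate and each path step at most two; the intermediate sites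
  -- cost one more unit below.
  have hσ : ∀ p ∈ evenHull Λ ∪ openCluster ρ₁ ρ₂ u (internalBoundary (evenHull Λ)),
      ∃ q ∈ Λ, p.1 ≤ q.1 ∧ q.1 ≤ p.1 + 2 * N + 1 ∧ p.2 ≤ q.2 ∧ q.2 ≤ p.2 + 2 * N + 1 := by
    rintro p (hp | hp)
    · obtain ⟨q, hq, h⟩ := bounds_of_mem_evenHull hp
      exact ⟨q, hq, by omega⟩
    · obtain ⟨r, hr, n, hn⟩ := exists_mem_reach_of_mem_openCluster hp
      have hnN : n < N := by
        by_contra h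
        have := reach_eq_empty_of_le ρ₁ ρ₂ u (not_lt.1 h)
          (reach_eq_empty_of_pathCount ρ₁ ρ₂ u (hN r hr))
        simp [this] at hn
      obtain ⟨q, hq, h⟩ := bounds_of_mem_evenHull hr.1
      have := bounds_of_mem_reach hn
      exact ⟨q, hq, by omega⟩
  rcases hp with hp | ⟨r, hr, -, hpr⟩
  · obtain ⟨q, hq, h⟩ := hσ p hp
    exact ⟨q, hq, by omega⟩
  · obtain ⟨q, hq, h⟩ := hσ r (hr.imp_left fun h => h.1)
    refine ⟨q, hq, ?_⟩
    rcases hpr with rfl | rfl <;> simp only [leftParent, belowParent] <;> omega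

theorem evenHull_subset : evenHull Λ ⊆ Λ ∪ (leftParent '' internalBoundary Λ ∪
    belowParent '' internalBoundary Λ) := by
  rintro p (hp | ⟨q, hq, -, rfl | rfl⟩)
  · exact Or.inl hp
  · by_cases h : leftParent q ∈ Λ
    · exact Or.inl h
    · exact Or.inr (Or.inl ⟨q, ⟨hq, Or.inl h⟩, rfl⟩)
  · by_cases h : belowParent q ∈ Λ
    · exact Or.inl h
    · exact Or.inr (Or.inr ⟨q, ⟨hq, Or.inr h⟩, rfl⟩)

/-- A parent missing from the hull is also missing from `Λ`, and a site newly added to `Λ` has a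
child on the boundary of `Λ`. -/
theorem internalBoundary_evenHull_subset : internalBoundary (evenHull Λ) ⊆
    internalBoundary Λ ∪ (leftParent '' internalBoundary Λ ∪
      belowParent '' internalBoundary Λ) := by
  rintro p ⟨hp, hp'⟩
  refine (evenHull_subset hp).imp_left fun hpΛ => ⟨hpΛ, ?_⟩
  exact hp'.imp (fun h h' => h (Or.inl h')) fun h h' => h (Or.inl h')

theorem count_hullBoundary_le : Measure.count (internalBoundary Λ ∪
    (leftParent '' internalBoundary Λ ∪ belowParent '' internalBoundary Λ)) ≤ 3 * Measure.count (internalBoundary Λ) := by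
  have h : ∀ f : Site → Site, Measure.count (f '' internalBoundary Λ) ≤
      Measure.count (internalBoundary Λ) := fun f => by
    rw [← encard_eq_count, ← encard_eq_count]
    exact_mod_cast Set.encard_image_le _ _
  refine (measure_union_le _ _).trans ((add_le_add_right (measure_union_le _ _) _).trans ?_)
  calc _ ≤ Measure.count (internalBoundary Λ) + (Measure.count (internalBoundary Λ) +
        Measure.count (internalBoundary Λ)) :=
        add_le_add le_rfl (add_le_add (h _) (h _))
    _ = _ := by ring

variable (ρ₁ ρ₂ u Λ) in
/-- The size of the simulation region is controlled by the number of open paths. -/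
theorem count_simulationRegion_le :
    Measure.count (simulationRegion ρ₁ ρ₂ u (evenHull Λ)) ≤ Measure.count Λ +
      3 * ∑' q : ↥(internalBoundary Λ ∪ (leftParent '' internalBoundary Λ ∪
        belowParent '' internalBoundary Λ)), ∑' n, pathCount ρ₁ ρ₂ u n q := by
  set B := internalBoundary Λ ∪ (leftParent '' internalBoundary Λ ∪
    belowParent '' internalBoundary Λ) with hB
  -- Length zero is included, so `R` contains `B` as well as the open cluster. Outside `Λ`, the
  -- region consists of sites of `R` and of their two lattice parents, whence the factor `3`.
  set R := ⋃ q ∈ B, ⋃ n, reach ρ₁ ρ₂ u n q with hR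
  have hRc : Measure.count R ≤ ∑' q : B, ∑' n, pathCount ρ₁ ρ₂ u n q :=
    (measure_biUnion_le _ (Set.to_countable B) _).trans (ENNReal.tsum_le_tsum fun q =>
      (measure_iUnion_le _).trans (ENNReal.tsum_le_tsum fun n => count_reach_le ρ₁ ρ₂ u n q))
  have himg : ∀ f : Site → Site, Measure.count (f '' R) ≤ Measure.count R := fun f => by
    rw [← encard_eq_count, ← encard_eq_count]
    exact_mod_cast Set.encard_image_le _ _
  have hBR : B ⊆ R := fun q hq => Set.mem_biUnion hq (Set.mem_iUnion.2 ⟨0, rfl⟩)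
  have hσR : internalBoundary (evenHull Λ) ∪
      openCluster ρ₁ ρ₂ u (internalBoundary (evenHull Λ)) ⊆ R := by
    rintro p (hp | hp)
    · exact hBR (internalBoundary_evenHull_subset hp)
    · obtain ⟨q, hq, n, hn⟩ := exists_mem_reach_of_mem_openCluster hp
      exact Set.mem_biUnion (internalBoundary_evenHull_subset hq) (Set.mem_iUnion.2 ⟨n, hn⟩)
  have hD : simulationRegion ρ₁ ρ₂ u (evenHull Λ) ⊆
      Λ ∪ (R ∪ (leftParent '' R ∪ belowParent '' R)) := by
    rintro p ((hp | hp) | ⟨q, hq, -, rfl | rfl⟩)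
    · exact (evenHull_subset hp).imp_right fun h => Or.inl (hBR (Or.inr h))
    · exact Or.inr (Or.inl (hσR (Or.inr hp)))
    · exact Or.inr (Or.inr (Or.inl ⟨q, hσR hq, rfl⟩))
    · exact Or.inr (Or.inr (Or.inr ⟨q, hσR hq, rfl⟩))
  calc _ ≤ Measure.count Λ + (Measure.count R + (Measure.count R + Measure.count R)) := by
        refine (measure_mono hD).trans ((measure_union_le _ _).trans ?_)
        gcongr
        refine (measure_union_le _ _).trans ?_
        gcongr
        exact (measure_union_le _ _).trans (add_le_add (himg _) (himg _))
    _ = Measure.count Λ + 3 * Measure.count R := by ring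
    _ ≤ _ := by gcongr

end Region

/-- Here the threshold `2/3` enters: a block has three parents, and the exploration must be
subcritical. -/
theorem pathRate_lt_one {ρ₁ ρ₂ : ℝ} (hρ : 2 / 3 < ρ₁ ^ 2 * ρ₂) :
    3 * ENNReal.ofReal (1 - ρ₁ ^ 2 * ρ₂) < 1 := by
  rw [← ENNReal.ofReal_ofNat 3, ← ENNReal.ofReal_mul (by norm_num), ← ENNReal.ofReal_one,
    ENNReal.ofReal_lt_ofReal_iff one_pos]
  linarith

/-- The expected size of the simulation region. -/
theorem lintegral_simulationRegion_le {ρ₁ ρ₂ : ℝ} (h10 : 0 ≤ ρ₁) (h11 : ρ₁ ≤ 1) (h20 : 0 ≤ ρ₂)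
    (h21 : ρ₂ ≤ 1) (Λ : Set Site) :
    ∫⁻ u, ((simulationRegion ρ₁ ρ₂ u (evenHull Λ)).encard : ℝ≥0∞) ∂uniformField ≤
      (Λ.encard : ℝ≥0∞) + 9 * (1 - 3 * ENNReal.ofReal (1 - ρ₁ ^ 2 * ρ₂))⁻¹ *
        ((internalBoundary Λ).encard : ℝ≥0∞) := by
  simp only [encard_eq_count]
  refine (lintegral_mono fun u => count_simulationRegion_le ρ₁ ρ₂ u Λ).trans ?_
  have hm := measurable_pathCount ρ₁ ρ₂
  have hB := count_hullBoundary_le (Λ := Λ)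
  set B := internalBoundary Λ ∪ (leftParent '' internalBoundary Λ ∪
    belowParent '' internalBoundary Λ)
  set θ := 3 * ENNReal.ofReal (1 - ρ₁ ^ 2 * ρ₂)
  rw [lintegral_add_left measurable_const, lintegral_const_mul _ (by fun_prop),
    lintegral_tsum (fun q => by fun_prop), lintegral_const, measure_univ, mul_one]
  refine add_le_add le_rfl ?_
  -- A geometric series for each endpoint; the constant `9` is this `3` times the `3` bounding the
  -- enlarged boundary.
  calc 3 * ∑' q : B, ∫⁻ u, ∑' n, pathCount ρ₁ ρ₂ u n q ∂uniformField
      ≤ 3 * ∑' _ : B, (1 - θ)⁻¹ := by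
        gcongr with q
        rw [lintegral_tsum (fun n => (hm n q).aemeasurable), ← ENNReal.tsum_geometric]
        exact ENNReal.tsum_le_tsum fun n => lintegral_pathCount_le h10 h11 h20 h21 n q
    _ = 3 * (Measure.count B * (1 - θ)⁻¹) := by
        rw [ENNReal.tsum_const, ← encard_eq_count]
        rfl
    _ ≤ 3 * ((3 * Measure.count (internalBoundary Λ)) * (1 - θ)⁻¹) := by gcongr
    _ = _ := by ring

/-! ### Long open paths are unlikely -/

/-- The event that an open path of length `n` ends on the boundary of the even hull of `Λ`. -/
def longPath (ρ₁ ρ₂ : ℝ) (Λ : Set Site) (n : ℕ) : Set (Site → ℝ × ℝ) :=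
  {u | ∃ q ∈ internalBoundary (evenHull Λ), 1 ≤ pathCount ρ₁ ρ₂ u n q}

theorem longPath_eq (ρ₁ ρ₂ : ℝ) (Λ : Set Site) (n : ℕ) : longPath ρ₁ ρ₂ Λ n =
    ⋃ q ∈ internalBoundary (evenHull Λ), {u | 1 ≤ pathCount ρ₁ ρ₂ u n q} := by
  ext u
  simp [longPath]

/-- Markov's inequality at level one for each path count, and a union bound over the endpoints. -/
theorem measure_longPath_le {ρ₁ ρ₂ : ℝ} (h10 : 0 ≤ ρ₁) (h11 : ρ₁ ≤ 1) (h20 : 0 ≤ ρ₂)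
    (h21 : ρ₂ ≤ 1) (Λ : Set Site) (n : ℕ) : uniformField (longPath ρ₁ ρ₂ Λ n) ≤
      3 * Measure.count (internalBoundary Λ) * (3 * ENNReal.ofReal (1 - ρ₁ ^ 2 * ρ₂)) ^ n := by
  rw [longPath_eq]
  calc _ ≤ ∑' q : internalBoundary (evenHull Λ), uniformField {u | 1 ≤ pathCount ρ₁ ρ₂ u n q} :=
        measure_biUnion_le _ (Set.to_countable _) _
    _ ≤ ∑' _ : internalBoundary (evenHull Λ), (3 * ENNReal.ofReal (1 - ρ₁ ^ 2 * ρ₂)) ^ n := by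
        gcongr with q
        refine le_trans ?_ (lintegral_pathCount_le h10 h11 h20 h21 n q)
        simpa using mul_meas_ge_le_lintegral (μ := uniformField)
          (measurable_pathCount ρ₁ ρ₂ n q) 1
    _ = Measure.count (internalBoundary (evenHull Λ)) *
          (3 * ENNReal.ofReal (1 - ρ₁ ^ 2 * ρ₂)) ^ n := by
        rw [ENNReal.tsum_const, ← encard_eq_count]
        rfl
    _ ≤ _ := by
        gcongr
        exact (measure_mono internalBoundary_evenHull_subset).trans count_hullBoundary_le

theorem tendsto_measure_longPath {ρ₁ ρ₂ : ℝ} (h10 : 0 ≤ ρ₁) (h11 : ρ₁ ≤ 1) (h20 : 0 ≤ ρ₂)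
    (h21 : ρ₂ ≤ 1) (hρ : 2 / 3 < ρ₁ ^ 2 * ρ₂) (Λ : Finset Site) :
    Tendsto (fun n => uniformField (longPath ρ₁ ρ₂ Λ n)) atTop (𝓝 0) := by
  have hfin : Measure.count (internalBoundary (Λ : Set Site)) ≠ ∞ :=
    ((measure_mono fun p hp => hp.1).trans_lt
      (Measure.count_apply_lt_top.2 Λ.finite_toSet)).ne
  refine tendsto_of_tendsto_of_tendsto_of_le_of_le tendsto_const_nhds ?_ (fun _ => zero_le)
    (fun n => measure_longPath_le h10 h11 h20 h21 (Λ : Set Site) n)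
  have := ENNReal.Tendsto.const_mul (a := 3 * Measure.count (internalBoundary (Λ : Set Site)))
    (ENNReal.tendsto_pow_atTop_nhds_zero_of_lt_one (pathRate_lt_one hρ))
    (Or.inr (ENNReal.mul_ne_top (by simp) hfin))
  simpa using this

/-! ### The list of the sites of a box -/

theorem boxList_eq (M N : ℕ) : boxList M N =
    (List.range N).flatMap fun j : ℕ => (List.range M).map fun i : ℕ =>
      (((i : ℤ) + 1, (j : ℤ) + 1) : Site) := by
  simp [boxList, List.flatMap_map, List.map_map, Function.comp_def, ← List.map_eq_flatMap]

theorem mem_boxList {M N : ℕ} {p : Site} :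
    p ∈ boxList M N ↔ 1 ≤ p.1 ∧ p.1 ≤ M ∧ 1 ≤ p.2 ∧ p.2 ≤ N := by
  simp only [boxList_eq, List.mem_flatMap, List.mem_range, List.mem_map]
  constructor
  · rintro ⟨j, hj, i, hi, rfl⟩
    simp only
    omega
  · rintro ⟨h1, h2, h3, h4⟩
    exact ⟨(p.2 - 1).toNat, by omega, (p.1 - 1).toNat, by omega,
      Prod.ext (by simp only; omega) (by simp only; omega)⟩

/-- The row-by-row order is strict, which gives both the absence of repetitions and the precedence
of parents over children. -/
theorem pairwise_boxList (M N : ℕ) :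
    (boxList M N).Pairwise fun p q => p.2 < q.2 ∨ p.2 = q.2 ∧ p.1 < q.1 := by
  rw [boxList_eq, List.pairwise_flatMap]
  refine ⟨fun j _ => List.pairwise_map.2 (List.pairwise_lt_range.imp fun {a b} h =>
    Or.inr ⟨rfl, by simpa using h⟩), List.pairwise_lt_range.imp fun {i j} h => ?_⟩
  intro p hp q hq
  obtain ⟨_, _, rfl⟩ := List.mem_map.1 hp
  obtain ⟨_, _, rfl⟩ := List.mem_map.1 hq
  exact Or.inl (by simpa using h)

/-- The sites of the box `v + {1, …, M} × {1, …, N}`, row after row. -/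
def boxListAt (v : Site) (M N : ℕ) : List Site := (boxList M N).map (· + v)

theorem mem_boxListAt {v : Site} {M N : ℕ} {p : Site} : p ∈ boxListAt v M N ↔
    v.1 + 1 ≤ p.1 ∧ p.1 ≤ v.1 + M ∧ v.2 + 1 ≤ p.2 ∧ p.2 ≤ v.2 + N := by
  simp only [boxListAt, List.mem_map]
  constructor
  · rintro ⟨q, hq, rfl⟩
    have := mem_boxList.1 hq
    simp only [Prod.fst_add, Prod.snd_add]
    omega
  · intro h
    refine ⟨p - v, mem_boxList.2 ?_, sub_add_cancel p v⟩
    simp only [Prod.fst_sub, Prod.snd_sub]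
    omega

theorem pairwise_boxListAt (v : Site) (M N : ℕ) :
    (boxListAt v M N).Pairwise fun p q => p.2 < q.2 ∨ p.2 = q.2 ∧ p.1 < q.1 := by
  refine List.pairwise_map.2 ((pairwise_boxList M N).imp fun h => ?_)
  simpa using h

theorem nodup_boxListAt (v : Site) (M N : ℕ) : (boxListAt v M N).Nodup :=
  (pairwise_boxListAt v M N).imp fun h h' => by
    subst h'
    omega

theorem boxListAt_pairwise_not_parent (v : Site) (M N : ℕ) :
    (boxListAt v M N).Pairwise fun p q => q ≠ leftParent p ∧ q ≠ belowParent p :=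
  (pairwise_boxListAt v M N).imp fun h => by
    constructor <;> rintro rfl <;> simp only [leftParent, belowParent] at h <;> omega

/-! ### Translation of the sequential construction -/

section Translation

variable {E : Type*} [MeasurableSpace E]

theorem measurable_translate (w : Site) :
    Measurable fun (y : Site → E) (p : Site) => y (p - w) := by fun_prop

theorem measurable_resample_kernel (K : Kernel (E × E) E) [IsMarkovKernel K] (q : Site) :
    Measurable fun y : Site → E =>
      (K (y (leftParent q), y (belowParent q))).map (Function.update y q) := by
  let κ : Kernel (Site → E) E := K.comap (fun y => (y (leftParent q), y (belowParent q)))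
    (by fun_prop)
  have h : (fun y : Site → E =>
      (K (y (leftParent q), y (belowParent q))).map (Function.update y q)) =
      (Kernel.id ×ₖ κ).map fun w : (Site → E) × E => Function.update w.1 q w.2 := by
    funext y
    rw [Kernel.map_apply _ measurable_update', Kernel.prod_apply, Kernel.id_apply,
      Measure.dirac_prod, Measure.map_map measurable_update' measurable_prodMk_left]
    rfl
  rw [h]
  exact Kernel.measurable _

/-- The kernel is the same at all sites, so redrawing commutes with translation, by vectors of
either parity. -/
theorem resample_map_translate (K : Kernel (E × E) E) [IsMarkovKernel K]
    (μ : Measure (Site → E)) (q w : Site) :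
    (resample K μ q).map (fun y p => y (p - w)) =
      resample K (μ.map fun y p => y (p - w)) (q + w) := by
  have hT := measurable_translate (E := E) w
  have hk := measurable_resample_kernel K
  refine Measure.ext fun A hA => ?_
  rw [Measure.map_apply hT hA, resample, resample, Measure.bind_apply (hT hA) (hk q).aemeasurable,
    Measure.bind_apply hA (hk (q + w)).aemeasurable,
    lintegral_map (f := fun y : Site → E => (K (y (leftParent (q + w)), y (belowParent (q + w)))).map
      (Function.update y (q + w)) A) ((Measure.measurable_coe hA).comp (hk (q + w))) hT]
  refine lintegral_congr fun y => ?_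
  have hl : leftParent (q + w) - w = leftParent q := by
    simp [leftParent, Prod.ext_iff]
    ring
  have hb : belowParent (q + w) - w = belowParent q := by
    simp [belowParent, Prod.ext_iff]
    ring
  beta_reduce
  rw [hl, hb, Measure.map_apply (measurable_update y) (hT hA),
    Measure.map_apply (measurable_update _) hA]
  congr 1
  ext e
  have : (fun p => Function.update y q e (p - w)) =
      Function.update (fun p => y (p - w)) (q + w) e := by
    funext p
    by_cases hp : p = q + w
    · simp [hp]
    · rw [Function.update_of_ne hp, Function.update_of_ne fun h => hp (sub_eq_iff_eq_add.1 h)]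
  simp only [Set.mem_preimage, this]

theorem foldl_resample_map_translate (K : Kernel (E × E) E) [IsMarkovKernel K]
    (L : List Site) (μ : Measure (Site → E)) (w : Site) :
    (L.foldl (resample K) μ).map (fun y p => y (p - w)) =
      (L.map (· + w)).foldl (resample K) (μ.map fun y p => y (p - w)) := by
  induction L generalizing μ with
  | nil => rfl
  | cons q L ih =>
    rw [List.foldl_cons, ih, resample_map_translate, List.map_cons, List.foldl_cons]

end Translation

namespace MixtureCoupling

variable {E : Type*} [MeasurableSpace E] {K : Kernel (E × E) E} {C : Set E} {φ : Measure E}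
  {ρ₁ ρ₂ : ℝ} (F : MixtureCoupling K C φ ρ₁ ρ₂)

/-- The field in a translated box, realized by the coupling in a box at another place. -/
theorem shiftedBoxLaw_eq_map_seqField [IsMarkovKernel K] (hC : MeasurableSet C)
    (h10 : 0 ≤ ρ₁) (h11 : ρ₁ ≤ 1) (h20 : 0 ≤ ρ₂) (h21 : ρ₂ ≤ 1) (x : Site → E)
    (h l m n : ℕ) (v : Site) :
    shiftedBoxLaw K x h l m n = uniformField.map fun u (p : boxSites m n) =>
      F.seqField (boxListAt (v - ((h : ℤ), (l : ℤ))) (h + m) (l + n))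
        (fun p => x (p - (v - ((h : ℤ), (l : ℤ))))) u (p.1 + v) := by
  have hr : Measurable fun (y : Site → E) (p : boxSites m n) => y (p.1 + v) := by fun_prop
  have hs := F.measurable_seqField hC (boxListAt (v - ((h : ℤ), (l : ℤ))) (h + m) (l + n))
    (fun p => x (p - (v - ((h : ℤ), (l : ℤ)))))
  have h1 := Measure.map_map (μ := uniformField) hr hs
  refine Eq.trans ?_ h1
  have hT := measurable_translate (E := E) (v - ((h : ℤ), (l : ℤ)))
  -- The whole construction is moved by `v - (h, l)`: the observed box stays at `v` while its
  -- boundary conditions recede as `h, l` grow.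
  rw [F.map_seqField hC h10 h11 h20 h21 (nodup_boxListAt _ _ _), boxListAt,
    ← Measure.map_dirac' hT x, ← foldl_resample_map_translate, Measure.map_map hr hT,
    shiftedBoxLaw, unilateralLaw]
  congr 1
  funext y p
  simp only [Function.comp_apply]
  congr 1
  abel

/-! ### The simulated configuration agrees with every solution of the recursion -/

/-- Induction along diagonals. At a boundary site of the region the block variable is `0`, so `Y`
lies in `C` at both parents and `s₀` returns `f₀ (U₁)`, the value from which `upsilon` starts. At
the other sites both configurations obey the same recursion. The parents are required to lie in `S`
because `Y` is controlled only there. -/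
theorem upsilon_simulationRegion_eq {u : Site → ℝ × ℝ} {Λ : Set Site}
    (hfin : (simulationRegion ρ₁ ρ₂ u (evenHull Λ)).Finite) {S : Set Site} {Y : Site → E}
    (hY : ∀ p ∈ S, Y p = F.s p (u p) (Y (leftParent p)) (Y (belowParent p)))
    (hYC : ∀ p ∈ S, ¬ Even (p.1 + p.2) → (u p).2 ∈ Set.Ioo 0 ρ₁ → Y p ∈ C)
    (hS : ∀ p ∈ simulationRegion ρ₁ ρ₂ u (evenHull Λ),
      p ∈ S ∧ leftParent p ∈ S ∧ belowParent p ∈ S) :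
    ∀ p ∈ simulationRegion ρ₁ ρ₂ u (evenHull Λ),
      F.upsilon (simulationRegion ρ₁ ρ₂ u (evenHull Λ)) u p = Y p := by
  set D := simulationRegion ρ₁ ρ₂ u (evenHull Λ) with hD
  obtain ⟨b, hb⟩ : ∃ b : ℤ, ∀ p ∈ D, b ≤ p.1 + p.2 := by
    obtain ⟨b, hb⟩ := (hfin.image fun p => p.1 + p.2).bddBelow
    exact ⟨b, fun p hp => hb ⟨p, hp, rfl⟩⟩
  suffices h : ∀ k : ℕ, ∀ p ∈ D, p.1 + p.2 < b + k → F.upsilon D u p = Y p from fun p hp =>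
    h (p.1 + p.2 - b + 1).toNat p hp (by have := hb p hp; omega)
  intro k
  induction k with
  | zero =>
    intro p hp h
    have := hb p hp
    simp only [Nat.cast_zero] at h
    omega
  | succ k ih =>
    intro p hp h
    push_cast at h
    by_cases hpb : p ∈ internalBoundary D
    · obtain ⟨heven, hW⟩ := internalBoundary_simulationRegion hpb
      have hW' : (u (leftParent p)).2 ∈ Set.Ioo 0 ρ₁ ∧ (u (belowParent p)).2 ∈ Set.Ioo 0 ρ₁ ∧
          (u p).2 ∈ Set.Ioo 0 ρ₂ := by
        by_contra hne
        exact one_ne_zero ((if_neg hne).symm.trans hW)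
      obtain ⟨h1, h2, h3⟩ := hS p hp
      have hl := hYC _ h2 (not_even_leftParent heven) hW'.1
      have hbe := hYC _ h3 (not_even_belowParent heven) hW'.2.1
      rw [hY p h1, upsilon, field_of_notMem _ _ _ _ fun h => h.2 hpb, s, if_pos heven, s₀,
        if_pos ⟨hl, hbe⟩, if_pos hW'.2.2]
    · have hpar : leftParent p ∈ D ∧ belowParent p ∈ D := by
        by_contra hne
        exact hpb ⟨hp, by tauto⟩
      rw [upsilon, field_of_mem _ (hfin.subset Set.sdiff_subset) _ _ ⟨hp, hpb⟩, hY p (hS p hp).1,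
        ← ih _ hpar.1, ← ih _ hpar.2, upsilon]
      · simp only [belowParent]
        omega
      · simp only [leftParent]
        omega

/-- Off the event of a long open path, the simulated configuration is almost surely the field
constructed in a large box. -/
theorem ae_upsilon_eq_seqField [IsMarkovKernel K] (hC : MeasurableSet C)
    (hKC : ∀ y, 0 < (K y).real C) (Λ : Finset Site) (k : ℕ) (x : Site → E) (v : Site) (M N : ℕ)
    (hΛ : ∀ q ∈ Λ, v.1 + 2 * k + 4 ≤ q.1 ∧ q.1 ≤ v.1 + M ∧
      v.2 + 2 * k + 4 ≤ q.2 ∧ q.2 ≤ v.2 + N) :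
    ∀ᵐ u ∂uniformField, u ∉ longPath ρ₁ ρ₂ Λ k → ∀ p ∈ Λ,
      F.upsilon (simulationRegion ρ₁ ρ₂ u (evenHull Λ)) u p =
        F.seqField (boxListAt v M N) x u p := by
  filter_upwards [F.ae_seqField_mem hC hKC (nodup_boxListAt v M N) x] with u hu hlong p hp
  have hbd : ∀ p ∈ simulationRegion ρ₁ ρ₂ u (evenHull Λ), ∃ q ∈ Λ,
      p.1 ≤ q.1 ∧ q.1 ≤ p.1 + 2 * k + 2 ∧ p.2 ≤ q.2 ∧ q.2 ≤ p.2 + 2 * k + 2 := fun p hp =>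
    bounds_of_mem_simulationRegion (fun q hq => not_le.1 fun h => hlong ⟨q, hq, h⟩) hp
  -- The margin `2 k + 4` is `2 k + 2` for the region, one for the parents, and one because the box
  -- starts at `v + 1`.
  have hS : ∀ p ∈ simulationRegion ρ₁ ρ₂ u (evenHull Λ), p ∈ {p | p ∈ boxListAt v M N} ∧
      leftParent p ∈ {p | p ∈ boxListAt v M N} ∧ belowParent p ∈ {p | p ∈ boxListAt v M N} := by
    intro p hp
    obtain ⟨q, hq, h⟩ := hbd p hp
    have := hΛ q hq
    refine ⟨mem_boxListAt.2 (by omega), mem_boxListAt.2 ?_, mem_boxListAt.2 ?_⟩ <;>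
      simp only [leftParent, belowParent] <;> omega
  refine F.upsilon_simulationRegion_eq ((boxListAt v M N).finite_toSet.subset fun p hp =>
    (hS p hp).1) (S := {p | p ∈ boxListAt v M N}) (fun p hp => F.seqField_of_mem
      (nodup_boxListAt v M N) (boxListAt_pairwise_not_parent v M N) x u hp) (fun p hp => hu p hp)
    hS p (subset_simulationRegion hp)

end MixtureCoupling

/-! ### Total variation distance -/

theorem abs_sub_le_tvDistance {S : Type*} [MeasurableSpace S] (μ ν : Measure S)
    [IsProbabilityMeasure μ] [IsProbabilityMeasure ν] {A : Set S} (hA : MeasurableSet A) :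
    |μ.real A - ν.real A| ≤ tvDistance μ ν := by
  refine le_ciSup (f := fun A : {A : Set S // MeasurableSet A} => |μ.real A.1 - ν.real A.1|)
    ⟨1, ?_⟩ ⟨A, hA⟩
  rintro _ ⟨B, rfl⟩
  refine abs_sub_le_of_le_of_le measureReal_nonneg measureReal_le_one measureReal_nonneg
    measureReal_le_one |>.trans (by norm_num)

/-- The coupling inequality: outside `B`, an event for one variable is almost surely the same event
for the other. -/
theorem tvDistance_map_le {Ω S : Type*} [MeasurableSpace Ω] [MeasurableSpace S] (μ : Measure Ω)
    [IsFiniteMeasure μ] {f g : Ω → S} (hf : AEMeasurable f μ) (hg : AEMeasurable g μ) {B : Set Ω}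
    (h : ∀ᵐ ω ∂μ, ω ∉ B → f ω = g ω) : tvDistance (μ.map f) (μ.map g) ≤ μ.real B := by
  have key : ∀ {f g : Ω → S}, AEMeasurable f μ → AEMeasurable g μ →
      (∀ᵐ ω ∂μ, ω ∉ B → f ω = g ω) → ∀ A, MeasurableSet A →
      (μ.map f).real A - (μ.map g).real A ≤ μ.real B := by
    intro f g hf hg h A hA
    rw [map_measureReal_apply_of_aemeasurable hf hA, map_measureReal_apply_of_aemeasurable hg hA,
      sub_le_iff_le_add']
    refine le_trans (ENNReal.toReal_mono (measure_ne_top _ _) (measure_mono_ae ?_))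
      (measureReal_union_le _ _)
    filter_upwards [h] with ω hω hωA
    by_cases hB : ω ∈ B
    · exact Or.inr hB
    · exact Or.inl (by rw [Set.mem_preimage, ← hω hB]; exact hωA)
  have : Nonempty {A : Set S // MeasurableSet A} := ⟨⟨∅, .empty⟩⟩
  refine ciSup_le fun A => abs_sub_le_iff.2 ⟨key hf hg h A.1 A.2, key hg hf ?_ A.1 A.2⟩
  filter_upwards [h] with ω hω hB using (hω hB).symm

/-! ### The stationary field -/

theorem exists_coordinate_bound (Λ : Finset Site) : ∃ b : ℕ, ∀ p ∈ Λ, |p.1| < b ∧ |p.2| < b := by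
  refine ⟨Λ.sup fun p => p.1.natAbs + p.2.natAbs + 1, fun p hp => ?_⟩
  have := Finset.le_sup (f := fun p : Site => p.1.natAbs + p.2.natAbs + 1) hp
  rw [Int.abs_eq_natAbs, Int.abs_eq_natAbs]
  omega

section Uniqueness

variable {E : Type*} [MeasurableSpace E]

theorem measurable_shift (v : Site) : Measurable fun (y : Site → E) p => y (p + v) := by fun_prop

theorem measurable_restrict_sites (Λ : Finset Site) :
    Measurable fun (y : Site → E) (p : Λ) => y p.1 := by fun_prop

/-- Uniform convergence in total variation of the fields in far boxes to a given law. -/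
def ConvergesTo (K : Kernel (E × E) E) (ν : Measure (Site → E)) : Prop :=
  ∀ m n : ℕ, ∀ ε > (0 : ℝ), ∀ᶠ q : ℕ × ℕ in atTop, ∀ x : Site → E,
    tvDistance (shiftedBoxLaw K x q.1 q.2 m n) (marginal ν (boxSites m n)) < ε

theorem isProbabilityMeasure_marginal (ν : Measure (Site → E)) [IsProbabilityMeasure ν]
    (Λ : Finset Site) : IsProbabilityMeasure (marginal ν Λ) :=
  Measure.isProbabilityMeasure_map (measurable_restrict_sites Λ).aemeasurable

theorem ConvergesTo.marginal_eq [Nonempty E] {K : Kernel (E × E) E}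
    (hprob : ∀ x h l m n, IsProbabilityMeasure (shiftedBoxLaw K x h l m n))
    {ν ν' : Measure (Site → E)} [IsProbabilityMeasure ν] [IsProbabilityMeasure ν']
    (h : ConvergesTo K ν) (h' : ConvergesTo K ν') (m n : ℕ) :
    marginal ν (boxSites m n) = marginal ν' (boxSites m n) := by
  have h1 := isProbabilityMeasure_marginal ν (boxSites m n)
  have h2 := isProbabilityMeasure_marginal ν' (boxSites m n)
  refine Measure.ext fun A hA => ?_
  rw [← measureReal_eq_measureReal_iff]
  refine eq_of_abs_sub_eq_zero (le_antisymm (le_of_forall_pos_lt_add fun ε hε => ?_)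
    (abs_nonneg _))
  obtain ⟨q, hq, hq'⟩ := ((h m n (ε / 2) (by linarith)).and (h' m n (ε / 2) (by linarith))).exists
  have x : Site → E := fun _ => Classical.arbitrary E
  have h3 := hprob x q.1 q.2 m n
  have e1 := (abs_sub_le_tvDistance _ _ hA).trans_lt (hq x)
  have e2 := (abs_sub_le_tvDistance _ _ hA).trans_lt (hq' x)
  rw [abs_lt] at e1 e2
  rw [zero_add, abs_lt]
  constructor <;> linarith

/-- A law is determined by the laws in all translates of boxes. -/
theorem eq_of_marginal_shift_eq {ν ν' : Measure (Site → E)} [IsProbabilityMeasure ν]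
    [IsProbabilityMeasure ν']
    (h : ∀ (v : Site) (m n : ℕ), marginal (ν.map fun y p => y (p + v)) (boxSites m n) =
      marginal (ν'.map fun y p => y (p + v)) (boxSites m n)) : ν = ν' := by
  refine IsProjectiveLimit.unique (P := fun Λ : Finset Site => ν'.map Λ.restrict)
    (fun Λ => ?_) fun Λ => rfl
  -- Boxes lie in the positive quadrant; translating by `(-b, -b)` makes one of side `2 b` cover
  -- `Λ`.
  obtain ⟨b, hb⟩ := exists_coordinate_bound Λ
  let v : Site := (-(b : ℤ), -(b : ℤ))
  have hmem : ∀ p : Λ, p.1 - v ∈ boxSites (2 * b) (2 * b) := fun p => by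
    have := hb p.1 p.2
    simp only [boxSites, v, Finset.mem_product, Finset.mem_Icc, Prod.fst_sub, Prod.snd_sub,
      abs_lt] at this ⊢
    push_cast
    omega
  let r : (boxSites (2 * b) (2 * b) → E) → Λ → E := fun y p => y ⟨p.1 - v, hmem p⟩
  have hr : Measurable r := by fun_prop
  have key : ∀ μ : Measure (Site → E), μ.map Λ.restrict =
      (marginal (μ.map fun y p => y (p + v)) (boxSites (2 * b) (2 * b))).map r := fun μ => by
    rw [marginal, Measure.map_map (measurable_restrict_sites _) (measurable_shift v),
      Measure.map_map hr ((measurable_restrict_sites _).comp (measurable_shift v))]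
    congr 1
    funext y p
    simp [r]
  rw [key ν, h, ← key ν']

theorem shift_shift (ν : Measure (Site → E)) (v w : Site) :
    (ν.map fun y p => y (p + w)).map (fun y p => y (p + v)) = ν.map fun y p => y (p + (v + w)) := by
  rw [Measure.map_map (measurable_shift v) (measurable_shift w)]
  congr 1
  funext y p
  simp [add_assoc]

end Uniqueness

namespace MixtureCoupling

variable {E : Type*} [MeasurableSpace E] {K : Kernel (E × E) E} {C : Set E} {φ : Measure E}
  {ρ₁ ρ₂ : ℝ} (F : MixtureCoupling K C φ ρ₁ ρ₂)

/-- The value at each site of the stationary field, as a function of the driving variables. -/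
noncomputable def equilibriumField (u : Site → ℝ × ℝ) : Site → E := fun p =>
  F.upsilon (simulationRegion ρ₁ ρ₂ u (evenHull (({p} : Finset Site) : Set Site))) u p

section

variable [IsMarkovKernel K] (hC : MeasurableSet C) (hKC : ∀ y, 0 < (K y).real C)
  (h10 : 0 ≤ ρ₁) (h11 : ρ₁ ≤ 1) (h20 : 0 ≤ ρ₂) (h21 : ρ₂ ≤ 1) (hρ : 2 / 3 < ρ₁ ^ 2 * ρ₂)

include hC hKC h10 h11 h20 h21 hρ

/-- The long path probabilities tend to zero, so almost surely some `k` admits no long path, and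
then every box of radius `n ≥ b + 2 k + 4` reproduces `upsilon`. -/
theorem ae_eventually_upsilon_eq (Λ : Finset Site) (x : Site → E) :
    ∀ᵐ u ∂uniformField, ∀ᶠ n : ℕ in atTop, ∀ p ∈ Λ,
      F.upsilon (simulationRegion ρ₁ ρ₂ u (evenHull Λ)) u p =
        F.seqField (boxListAt (-(n : ℤ), -(n : ℤ)) (2 * n) (2 * n)) x u p := by
  obtain ⟨b, hb⟩ := exists_coordinate_bound Λ
  have h1 : ∀ᵐ u ∂uniformField, ∃ k, u ∉ longPath ρ₁ ρ₂ Λ k := by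
    rw [ae_iff]
    refine le_antisymm (ge_of_tendsto' (tendsto_measure_longPath h10 h11 h20 h21 hρ Λ)
      fun k => measure_mono fun u hu => ?_) zero_le
    by_contra hk
    exact hu ⟨k, hk⟩
  have h2 : ∀ᵐ u ∂uniformField, ∀ k n : ℕ, b + 2 * k + 4 ≤ n → u ∉ longPath ρ₁ ρ₂ Λ k → ∀ p ∈ Λ,
      F.upsilon (simulationRegion ρ₁ ρ₂ u (evenHull Λ)) u p =
        F.seqField (boxListAt (-(n : ℤ), -(n : ℤ)) (2 * n) (2 * n)) x u p := by
    refine ae_all_iff.2 fun k => ae_all_iff.2 fun n => ?_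
    by_cases hn : b + 2 * k + 4 ≤ n
    · filter_upwards [F.ae_upsilon_eq_seqField hC hKC Λ k x (-(n : ℤ), -(n : ℤ)) (2 * n) (2 * n)
        (fun q hq => by
          have := hb q hq
          simp only [abs_lt] at this
          push_cast
          omega)] with u hu _ using hu
    · exact ae_of_all _ fun u h => absurd h hn
  filter_upwards [h1, h2] with u ⟨k, hk⟩ hu
  filter_upwards [eventually_ge_atTop (b + 2 * k + 4)] with n hn using hu k n hn hk

/-- The random region is never examined for measurability: `upsilon` is almost surely the eventual
value of measurable fields in growing boxes. -/
theorem aemeasurable_upsilon [StandardBorelSpace E] [Nonempty E] (Λ : Finset Site) {p : Site}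
    (hp : p ∈ Λ) : AEMeasurable (fun u =>
      F.upsilon (simulationRegion ρ₁ ρ₂ u (evenHull Λ)) u p) uniformField := by
  let _ := upgradeStandardBorel E
  have x : Site → E := fun _ => Classical.arbitrary E
  refine aemeasurable_of_tendsto_metrizable_ae' (f := fun (n : ℕ) u =>
    F.seqField (boxListAt (-(n : ℤ), -(n : ℤ)) (2 * n) (2 * n)) x u p)
    (fun n => ((measurable_pi_apply p).comp (F.measurable_seqField hC _ x)).aemeasurable) ?_
  filter_upwards [F.ae_eventually_upsilon_eq hC hKC h10 h11 h20 h21 hρ Λ x] with u hu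
  refine tendsto_const_nhds.congr' ?_
  filter_upwards [hu] with n hn using hn p hp

theorem aemeasurable_equilibriumField [StandardBorelSpace E] [Nonempty E] :
    AEMeasurable F.equilibriumField uniformField :=
  aemeasurable_pi_iff.2 fun p =>
    F.aemeasurable_upsilon hC hKC h10 h11 h20 h21 hρ {p} (Finset.mem_singleton_self p)

/-- The regions of `Λ` and of `{p}` differ, but both values at `p` equal that of one common large
box. -/
theorem ae_upsilon_eq_equilibriumField [Nonempty E] (Λ : Finset Site) :
    ∀ᵐ u ∂uniformField, ∀ p ∈ Λ,
      F.upsilon (simulationRegion ρ₁ ρ₂ u (evenHull Λ)) u p = F.equilibriumField u p := by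
  have x : Site → E := fun _ => Classical.arbitrary E
  have h := fun Λ => F.ae_eventually_upsilon_eq hC hKC h10 h11 h20 h21 hρ Λ x
  filter_upwards [h Λ, ae_all_iff.2 fun p : Site => h {p}] with u hu hu' p hp
  obtain ⟨n, hn, hn'⟩ := (hu.and (hu' p)).exists
  exact (hn p hp).trans (hn' p (Finset.mem_singleton_self p)).symm

/-- The simulated configuration has the law of the restriction of the stationary field. -/
theorem map_upsilon_eq_marginal [StandardBorelSpace E] [Nonempty E] (Λ : Finset Site) :
    uniformField.map (fun u (p : Λ) =>
      F.upsilon (simulationRegion ρ₁ ρ₂ u (evenHull (Λ : Set Site))) u p.1) =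
      marginal (uniformField.map F.equilibriumField) Λ := by
  have hm := F.aemeasurable_equilibriumField hC hKC h10 h11 h20 h21 hρ
  rw [marginal,
    AEMeasurable.map_map_of_aemeasurable (measurable_restrict_sites Λ).aemeasurable hm]
  refine Measure.map_congr ?_
  filter_upwards [F.ae_upsilon_eq_equilibriumField hC hKC h10 h11 h20 h21 hρ Λ] with u hu
  funext p
  exact hu p.1 p.2

/-- The exceptional event is a long path ending at the translated box. It involves neither the
boundary conditions nor `(h, l)`, hence the uniformity in `x`. -/
theorem convergesTo_shift_equilibriumField [StandardBorelSpace E] [Nonempty E] (v : Site) :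
    ConvergesTo K ((uniformField.map F.equilibriumField).map fun y p => y (p + v)) := by
  intro m n ε hε
  have hm := F.aemeasurable_equilibriumField hC hKC h10 h11 h20 h21 hρ
  set Λ : Finset Site := (boxSites m n).map (addRightEmbedding v) with hΛ
  obtain ⟨k, hk⟩ := ((tendsto_measure_longPath h10 h11 h20 h21 hρ Λ).eventually_lt_const
    (ENNReal.ofReal_pos.2 hε)).exists
  have hk' : uniformField.real (longPath ρ₁ ρ₂ Λ k) < ε :=
    (ENNReal.lt_ofReal_iff_toReal_lt (measure_ne_top _ _)).1 hk
  filter_upwards [eventually_ge_atTop ((2 * k + 4, 2 * k + 4) : ℕ × ℕ)] with q hq x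
  refine lt_of_le_of_lt ?_ hk'
  have hmarg : marginal ((uniformField.map F.equilibriumField).map fun y p => y (p + v))
      (boxSites m n) = uniformField.map fun u (p : boxSites m n) =>
        F.equilibriumField u (p.1 + v) := by
    rw [marginal, Measure.map_map (measurable_restrict_sites _) (measurable_shift v),
      AEMeasurable.map_map_of_aemeasurable
        ((measurable_restrict_sites _).comp (measurable_shift v)).aemeasurable hm]
    rfl
  rw [hmarg, F.shiftedBoxLaw_eq_map_seqField hC h10 h11 h20 h21 x q.1 q.2 m n v]
  refine tvDistance_map_le uniformField ?_ ?_ ?_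
  · exact (measurable_pi_iff.2 fun p : boxSites m n => (measurable_pi_apply (p.1 + v)).comp
      (F.measurable_seqField hC _ _)).aemeasurable
  · exact aemeasurable_pi_iff.2 fun p : boxSites m n => aemeasurable_pi_iff.1 hm (p.1 + v)
  · have hmem : ∀ p ∈ boxSites m n, p + v ∈ Λ := fun p hp =>
      Finset.mem_map_of_mem (addRightEmbedding v) hp
    have h := F.ae_upsilon_eq_seqField hC hKC Λ k
      (fun p => x (p - (v - ((q.1 : ℤ), (q.2 : ℤ))))) (v - ((q.1 : ℤ), (q.2 : ℤ))) (q.1 + m)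
      (q.2 + n) (by
        intro r hr
        obtain ⟨p, hp, rfl⟩ := Finset.mem_map.1 hr
        simp only [boxSites, Finset.mem_product, Finset.mem_Icc] at hp
        have h1 := hq.1
        have h2 := hq.2
        simp only [addRightEmbedding_apply, Prod.fst_add, Prod.snd_add, Prod.fst_sub,
          Prod.snd_sub] at h1 h2 ⊢
        push_cast
        omega)
    filter_upwards [h, F.ae_upsilon_eq_equilibriumField hC hKC h10 h11 h20 h21 hρ Λ]
      with u hu hu' hlong
    funext p
    rw [← hu hlong _ (hmem p.1 p.2), hu' _ (hmem p.1 p.2)]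

theorem isProbabilityMeasure_map_equilibriumField [StandardBorelSpace E] [Nonempty E] :
    IsProbabilityMeasure (uniformField.map F.equilibriumField) :=
  Measure.isProbabilityMeasure_map (F.aemeasurable_equilibriumField hC hKC h10 h11 h20 h21 hρ)

/-- The law of the stationary field is determined by the convergence of the fields with
boundary conditions. -/
theorem eq_map_equilibriumField [StandardBorelSpace E] [Nonempty E] {ν : Measure (Site → E)}
    [IsProbabilityMeasure ν] (hν : ∀ v : Site, ConvergesTo K (ν.map fun y p => y (p + v))) :
    ν = uniformField.map F.equilibriumField := by
  have := F.isProbabilityMeasure_map_equilibriumField hC hKC h10 h11 h20 h21 hρ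
  have hprob : ∀ x h l m n, IsProbabilityMeasure (shiftedBoxLaw K x h l m n) := by
    intro x h l m n
    rw [F.shiftedBoxLaw_eq_map_seqField hC h10 h11 h20 h21 x h l m n 0]
    exact Measure.isProbabilityMeasure_map (measurable_pi_iff.2 fun p : boxSites m n =>
      (measurable_pi_apply (p.1 + 0)).comp (F.measurable_seqField hC _ _)).aemeasurable
  refine eq_of_marginal_shift_eq fun v m n => ?_
  have h1 : ∀ μ : Measure (Site → E), IsProbabilityMeasure μ →
      IsProbabilityMeasure (μ.map fun y p => y (p + v)) := fun μ _ =>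
    Measure.isProbabilityMeasure_map (measurable_shift v).aemeasurable
  have := h1 ν inferInstance
  have := h1 (uniformField.map F.equilibriumField) inferInstance
  exact (hν v).marginal_eq hprob
    (F.convergesTo_shift_equilibriumField hC hKC h10 h11 h20 h21 hρ v) m n

/-- Stationarity follows from uniqueness of the limit: every translate of the law has the same
convergence property. -/
theorem isUniformEquilibrium_map_equilibriumField [StandardBorelSpace E] [Nonempty E] :
    IsUniformEquilibrium K (uniformField.map F.equilibriumField) := by
  have hprob := F.isProbabilityMeasure_map_equilibriumField hC hKC h10 h11 h20 h21 hρ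
  have hconv := F.convergesTo_shift_equilibriumField hC hKC h10 h11 h20 h21 hρ
  refine ⟨hprob, fun w => ?_, ?_⟩
  · have : IsProbabilityMeasure
        ((uniformField.map F.equilibriumField).map fun y p => y (p + w)) :=
      Measure.isProbabilityMeasure_map (measurable_shift w).aemeasurable
    refine F.eq_map_equilibriumField hC hKC h10 h11 h20 h21 hρ fun v => ?_
    rw [shift_shift]
    exact hconv (v + w)
  · have h0 := hconv 0
    simp only [add_zero] at h0
    rwa [show (fun (y : Site → E) (p : Site) => y p) = id from rfl, Measure.map_id] at h0

end

end MixtureCoupling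

theorem mainTheorem3 {E : Type*} [MeasurableSpace E] [StandardBorelSpace E]
    (K : Kernel (E × E) E) [IsMarkovKernel K]
    (C : Set E) (hC : MeasurableSet C) (φ : Measure E) [IsProbabilityMeasure φ]
    (ρ₁ ρ₂ : ℝ) (hρ₁ : 0 < ρ₁) (hρ₂ : 0 < ρ₂) (hρ : 2 / 3 < ρ₁ ^ 2 * ρ₂)
    (hKC : ∀ y₁ y₂ : E, ρ₁ ≤ (K (y₁, y₂)).real C)
    (hKφ : ∀ y₁ ∈ C, ∀ y₂ ∈ C, ∀ A : Set E, MeasurableSet A →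
      ρ₂ * φ.real A ≤ (K (y₁, y₂)).real A) :
    ∃ ν : Measure (Site → E), IsUniformEquilibrium K ν ∧
      Nonempty (MixtureCoupling K C φ ρ₁ ρ₂) ∧
      (∀ (F : MixtureCoupling K C φ ρ₁ ρ₂) (Λ : Finset Site),
        uniformField.map (fun u (p : Λ) =>
            F.upsilon (simulationRegion ρ₁ ρ₂ u (evenHull (Λ : Set Site))) u p.1) =
          marginal ν Λ) ∧
      ∃ c : ℝ≥0, ∀ Λ : Finset Site,
        (Λ.card : ℝ≥0∞) ≤
            ∫⁻ u, ((simulationRegion ρ₁ ρ₂ u (evenHull (Λ : Set Site))).encard : ℝ≥0∞)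
              ∂uniformField ∧
          ∫⁻ u, ((simulationRegion ρ₁ ρ₂ u (evenHull (Λ : Set Site))).encard : ℝ≥0∞)
              ∂uniformField ≤
            (Λ.card : ℝ≥0∞) + c * ((internalBoundary (Λ : Set Site)).encard : ℝ≥0∞) := by
  have : Nonempty E := φ.nonempty_of_neZero
  have hC0 : ∀ y, 0 < (K y).real C := fun y => hρ₁.trans_le (hKC y.1 y.2)
  have h11 : ρ₁ ≤ 1 := (hKC (Classical.arbitrary E) (Classical.arbitrary E)).trans
    measureReal_le_one
  have hCne : C.Nonempty := by
    by_contra h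
    have := hC0 (Classical.arbitrary _)
    simp [Set.not_nonempty_iff_eq_empty.1 h] at this
  obtain ⟨y, hy⟩ := hCne
  -- Total mass compared at a point of `C × C`; `C` is nonempty because it has positive mass under
  -- `K`.
  have h21 : ρ₂ ≤ 1 := by
    have := hKφ y hy y hy Set.univ .univ
    simpa using this
  obtain ⟨F⟩ := nonempty_mixtureCoupling K hC φ hρ₁ h11 hρ₂.le h21 hKC hKφ
  refine ⟨uniformField.map F.equilibriumField,
    F.isUniformEquilibrium_map_equilibriumField hC hC0 hρ₁.le h11 hρ₂.le h21 hρ, ⟨F⟩, ?_, ?_⟩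
  · intro G Λ
    have := F.isProbabilityMeasure_map_equilibriumField hC hC0 hρ₁.le h11 hρ₂.le h21 hρ
    -- The law built from `F` has the convergence property that characterizes the law built from
    -- `G`, so the two coincide.
    rw [G.map_upsilon_eq_marginal hC hC0 hρ₁.le h11 hρ₂.le h21 hρ,
      ← G.eq_map_equilibriumField hC hC0 hρ₁.le h11 hρ₂.le h21 hρ
        (F.convergesTo_shift_equilibriumField hC hC0 hρ₁.le h11 hρ₂.le h21 hρ)]
  · have hfin : 9 * (1 - 3 * ENNReal.ofReal (1 - ρ₁ ^ 2 * ρ₂))⁻¹ ≠ ∞ :=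
      ENNReal.mul_ne_top (by simp)
        (ENNReal.inv_ne_top.2 (tsub_pos_of_lt (pathRate_lt_one hρ)).ne')
    refine ⟨(9 * (1 - 3 * ENNReal.ofReal (1 - ρ₁ ^ 2 * ρ₂))⁻¹).toNNReal, fun Λ => ⟨?_, ?_⟩⟩
    · calc (Λ.card : ℝ≥0∞) = ∫⁻ _, (Λ.card : ℝ≥0∞) ∂uniformField := by simp
        _ ≤ _ := lintegral_mono fun u => by
          have := ENat.toENNReal_le.2 (Set.encard_le_encard (subset_simulationRegion (ρ₁ := ρ₁)
            (ρ₂ := ρ₂) (u := u) (Λ := (Λ : Set Site))))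
          rwa [Set.encard_coe_eq_coe_finsetCard] at this
    · rw [ENNReal.coe_toNNReal hfin]
      have := lintegral_simulationRegion_le hρ₁.le h11 hρ₂.le h21 (Λ : Set Site)
      rw [Set.encard_coe_eq_coe_finsetCard] at this
      exact this
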